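/- A robust Markov chain (RMC) consists of a finite state set $S$ with $n=|S|$, a cost function $c\colon S\to\mathbb R$, a successor set $\operatorname{succ}(s)\subseteq S$ for each $s$, and a nonempty compact uncertainty set $\mathcal P(s)\subseteq\Delta(\operatorname{succ}(s))$ for each $s$. It has $L_p$ uncertainty if $\mathcal P(s)=\{q\in\Delta(\operatorname{succ}(s)) : \|q-\hat p_s\|_p\le\delta(s)\}$ for some nominal $\hat p_s\in\Delta(\operatorname{succ}(s))$ and radius $\delta(s)$. A (positional adversary) policy is a map $\tau$ with $\tau(s)\in\mathcal P(s)$ for all $s$; $P^\tau$ is the matrix with rows $\tau(s)$. For a discount factor $\gamma\in[0,1)$ the value is $v^*(s)=\sup_\tau \mathbb E^\tau_s\bigl[\sum_{t\ge0}\gamma^t c(s_t)\bigr]$, where $(s_t)$ is the Markov chain with transition matrix $P^\tau$ started in $s$; a policy is optimal if it attains $v^*(s)$ for every $s$. To solve an RMC means to compute $v^*$ and an optimal policy. Policy iteration (RMC-PI) starts from an arbitrary policy $\tau^0$ and computes, for $t=1,2,\dots$, the vector $v^{t-1}=(I-\gamma P^{\tau^{t-1}})^{-1}c$ and, for every $s$,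 some $\tau^t(s)\in\arg\max_{q\in\mathcal P(s)}\{c(s)+\gamma\,q^\top v^{t-1}\}$; it stops at the first $t\ge1$ with $\tau^t=\tau^{t-1}$ and returns $\tau^t$. Ties are broken consistently if $v^{t+1}=v^{t}$ always implies $\tau^{t+2}=\tau^{t+1}$ (for example, if the maximizer chosen is a function of $s$ and the vector $v$). **Theorem.** There is an absolute constant $C$ such that, for every RMC with $n\ge2$ states and $L_1$ or $L_\infty$ uncertainty and every $\gamma\in[0,1)$, with $$N=C\,n^3\log n\cdot\max\Bigl\{1,\ \frac{\log\frac{1-\gamma}{n}}{\log\gamma}\Bigr\}$$ (the quotient is read as $0$ if $\gamma=0$), the following hold for all policies $\tau^0,\tau^1,\dots$ generated by RMC-PI (continued beyond the stopping time): 1. If ties are broken consistently, RMC-PI stops after at most $N$ iterations, and the policy $\tau^T$ that it returns is optimal, with $(I-\gamma P^{\tau^T})^{-1}c=v^*$. 2. However ties are broken, $\tau^t$ is optimal and $v^t=v^*$ for every $t\ge N$. 3. Each iteration amounts to solving two RMCs with uncertainty of the same kind: $v^t$ is the value vector of the RMC with the same states and costs and uncertainty sets $\{\tau^t(s)\}$;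 and the policies $\tau'$ with $\tau'(s)\in\arg\max_{q\in\mathcal P(s)}\{c(s)+\gamma q^\top v^t\}$ for all $s$ are exactly the restrictions to $\{z_s\}$ of the optimal policies of the RMC with $2n$ states $z_s,x_s$ $(s\in S)$ in which $z_s$ has cost $c(s)$ and moves to the states $x_{s'}$ according to $\mathcal P(s)$, and $x_s$ is absorbing with cost $(1-\gamma)v^t(s)$. In particular, for a fixed $\gamma\in(0,1)$ and consistent tie-breaking, RMC-PI stops after $O\bigl(n^3\log n\cdot\log(\frac{1-\gamma}{n})/\log\gamma\bigr)$ iterations. -/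

import Mathlib

open MeasureTheory ProbabilityTheory
open scoped ENNReal

noncomputable section

/-- A robust Markov chain with finite state space `S`: a cost function, the possible successors of
each state and, for each state, a nonempty compact set of probability vectors supported on the
successors. -/
structure RMC (S : Type*) [Fintype S] where
  cost : S → ℝ
  succ : S → Set S
  uncertainty : S → Set (stdSimplex ℝ S)
  supported : ∀ s, ∀ q ∈ uncertainty s, ∀ s' ∉ succ s, q s' = 0
  isCompact : ∀ s, IsCompact (uncertainty s)
  nonempty : ∀ s, (uncertainty s).Nonempty

/-- The probability measure on `S` given by a probability vector. -/
def stepMeasure {S : Type*} [Fintype S] [MeasurableSpace S] (q : stdSimplex ℝ S) : Measure S :=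
  ∑ s, ENNReal.ofReal (q s) • Measure.dirac s

instance {S : Type*} [Fintype S] [MeasurableSpace S] (q : stdSimplex ℝ S) :
    IsProbabilityMeasure (stepMeasure q) := by
  constructor
  simp only [stepMeasure, Measure.coe_finsetSum, Finset.sum_apply, Measure.smul_apply,
    measure_univ, smul_eq_mul, mul_one]
  rw [← ENNReal.ofReal_sum_of_nonneg (fun s _ => stdSimplex.zero_le q s)]
  simp

/-- The transition kernel: given the history `s₀, …, s_t`, the next state has law `τ s_t`. -/
def stepKernel {S : Type*} [Fintype S] [MeasurableSpace S] [DiscreteMeasurableSpace S]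
    (τ : S → stdSimplex ℝ S) (t : ℕ) : Kernel (Finset.Iic t → S) S where
  toFun h := stepMeasure (τ (h ⟨t, Finset.mem_Iic.2 le_rfl⟩))
  measurable' := (Measurable.of_discrete (f := fun s => stepMeasure (τ s))).comp
    (measurable_pi_apply _)

instance {S : Type*} [Fintype S] [MeasurableSpace S] [DiscreteMeasurableSpace S]
    (τ : S → stdSimplex ℝ S) (t : ℕ) : IsMarkovKernel (stepKernel τ t) :=
  ⟨fun h => inferInstanceAs
    (IsProbabilityMeasure (stepMeasure (τ (h ⟨t, Finset.mem_Iic.2 le_rfl⟩))))⟩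

/-- The probability measure on runs `ℕ → S` started in `s₀` when the transition vectors are `τ`. -/
def runMeasure {S : Type*} [Fintype S] [MeasurableSpace S] [DiscreteMeasurableSpace S]
    (τ : S → stdSimplex ℝ S) (s₀ : S) : Measure (ℕ → S) :=
  Kernel.traj (X := fun _ => S) (stepKernel τ) 0 (fun _ => s₀)

/-- The expected discounted cost `E_{s₀} [∑ₜ γ ^ t * c (sₜ)]`; `S` carries the discrete
sigma-algebra. -/
def expectedCost {S : Type*} [Fintype S] (γ : ℝ) (c : S → ℝ) (τ : S → stdSimplex ℝ S)
    (s₀ : S) : ℝ :=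
  letI : MeasurableSpace S := ⊤
  haveI : DiscreteMeasurableSpace S := ⟨fun _ => trivial⟩
  ∫ ω, ∑' t : ℕ, γ ^ t * c (ω t) ∂(runMeasure τ s₀)

namespace RMC

variable {S : Type*} [Fintype S]

/-- The uncertainty sets are `L_p` balls of probability vectors around a nominal transition
function, within the probability vectors supported on the successors. -/
def HasLpUncertainty (M : RMC S) (p : ℝ≥0∞) : Prop :=
  ∃ (nominal : S → stdSimplex ℝ S) (δ : S → ℝ),
    (∀ s, ∀ s' ∉ M.succ s, nominal s s' = 0) ∧
    ∀ s, M.uncertainty s = {q | (∀ s' ∉ M.succ s, q s' = 0) ∧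
      ‖(WithLp.toLp p (fun s' => q s' - nominal s s') : PiLp p fun _ : S => ℝ)‖ ≤ δ s}

/-- Positional adversary policies. -/
def IsPolicy (M : RMC S) (τ : S → stdSimplex ℝ S) : Prop :=
  ∀ s, τ s ∈ M.uncertainty s

/-- The value vector: the adversary maximizes the expected discounted cost. -/
def value (M : RMC S) (γ : ℝ) (s : S) : ℝ :=
  ⨆ τ : {τ : S → stdSimplex ℝ S // M.IsPolicy τ}, expectedCost γ M.cost τ.1 s

/-- A policy is optimal if it attains the value in every state. -/
def IsOptimal (M : RMC S) (γ : ℝ) (τ : S → stdSimplex ℝ S) : Prop :=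
  M.IsPolicy τ ∧ ∀ s, expectedCost γ M.cost τ s = M.value γ s

/-- Policy evaluation, `(I - γ P^τ)⁻¹ c`. -/
def policyEval [DecidableEq S] (M : RMC S) (γ : ℝ) (τ : S → stdSimplex ℝ S) : S → ℝ :=
  ((1 : Matrix S S ℝ) - γ • Matrix.of fun s s' => τ s s')⁻¹.mulVec M.cost

/-- Policy improvement: `τ'` maximizes `c s + γ * q ⬝ v` over the uncertainty set of every
state `s`. -/
def IsImprovement (M : RMC S) (γ : ℝ) (v : S → ℝ) (τ' : S → stdSimplex ℝ S) : Prop :=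
  ∀ s, τ' s ∈ M.uncertainty s ∧
    ∀ q ∈ M.uncertainty s,
      M.cost s + γ * ∑ s', q s' * v s' ≤ M.cost s + γ * ∑ s', τ' s s' * v s'

/-- The policies produced by policy iteration from an arbitrary initial policy, with arbitrary
choices among the maximizers. The stopping test is not part of this predicate. -/
def IsPolicyIteration [DecidableEq S] (M : RMC S) (γ : ℝ) (τ : ℕ → S → stdSimplex ℝ S) : Prop :=
  M.IsPolicy (τ 0) ∧ ∀ t, M.IsImprovement γ (M.policyEval γ (τ t)) (τ (t + 1))

/-- Ties among maximizers are broken consistently: if the value vector has not changed, then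
neither does the chosen maximizer. This holds if the maximizer is a function of the state and the
value vector, and also if the current choice is kept whenever it is still a maximizer. -/
def ConsistentTies [DecidableEq S] (M : RMC S) (γ : ℝ) (τ : ℕ → S → stdSimplex ℝ S) : Prop :=
  ∀ t, M.policyEval γ (τ (t + 1)) = M.policyEval γ (τ t) → τ (t + 2) = τ (t + 1)

/-- The number of iterations after which the loop `repeat … until τ t = τ (t - 1)` stops. -/
def StopsAt (τ : ℕ → S → stdSimplex ℝ S) (T : ℕ) : Prop :=
  IsLeast {t | 1 ≤ t ∧ τ t = τ (t - 1)} T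

/-- A Markov chain as a robust Markov chain with singleton uncertainty sets. -/
def ofChain (c : S → ℝ) (P : S → stdSimplex ℝ S) : RMC S where
  cost := c
  succ s := {s' | P s s' ≠ 0}
  uncertainty s := {P s}
  supported := by
    intro s q hq s' hs'
    rw [Set.mem_singleton_iff.1 hq]
    simpa using hs'
  isCompact _ := isCompact_singleton
  nonempty _ := Set.singleton_nonempty _

/-- The batch robust Markov chain of a vector `v`. The transient copy `inl s` of a state `s` has
the cost of `s` and moves to the copies `inr s'` according to the uncertainty set of `s`; the copy
`inr s` is absorbing with cost `(1 - γ) * v s`. -/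
def batch [DecidableEq S] (M : RMC S) (γ : ℝ) (v : S → ℝ) : RMC (S ⊕ S) where
  cost := Sum.elim M.cost fun s => (1 - γ) * v s
  succ := Sum.elim (fun s => Sum.inr '' M.succ s) fun s => {Sum.inr s}
  uncertainty := Sum.elim (fun s => stdSimplex.map Sum.inr '' M.uncertainty s)
    fun s => {stdSimplex.vertex (Sum.inr s)}
  supported := by
    rintro (s | s) q hq s' hs'
    · obtain ⟨r, hr, rfl⟩ := hq
      rw [stdSimplex.map_coe, FunOnFinite.linearMap_apply_apply]
      refine Finset.sum_eq_zero fun x hx => ?_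
      refine M.supported s r hr x fun hxs => hs' ?_
      exact ⟨x, hxs, (Finset.mem_filter.1 hx).2⟩
    · rw [Set.mem_singleton_iff.1 hq]
      have : s' ≠ Sum.inr s := hs'
      simp [this]
  isCompact := by
    rintro (s | s)
    · exact (M.isCompact s).image (stdSimplex.continuous_map _)
    · exact isCompact_singleton
  nonempty := by
    rintro (s | s)
    · exact (M.nonempty s).image _
    · exact Set.singleton_nonempty _

end RMC

end

/- The regret of a distribution at a state is its loss in Bellman's equation. Among the vertices
that are greedy for the current values, the largest regret is controlled by the current error and
controls the next one, so it halves whenever the error of policy iteration has shrunk by the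
factor `(1 - γ) / 2`, which takes about `log ((1 - γ) / n) / log γ` iterations. At a vertex of an
`L₁` or `L∞` ball all coordinates but one lie in `{0, r s, r s ± d}`, so all these regrets are
combinations with coefficients in `{-1, 0, 1}` of the same `O(n ^ 3)` real numbers. Given
`O(n ^ 3 * log n)` such combinations, Siegel's lemma provides a nontrivial linear relation between
them that again has coefficients in `{-1, 0, 1}`. Positive numbers that keep halving satisfy no
such relation, because the leading term outweighs all later ones. -/

section StochasticVector

open scoped Matrix

variable {S : Type*} [Fintype S]

lemma dotProduct_le_of_forall_le (q : stdSimplex ℝ S) {x : S → ℝ} {a : ℝ} (h : ∀ s, x s ≤ a) :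
    ⇑q ⬝ᵥ x ≤ a :=
  calc ⇑q ⬝ᵥ x ≤ ⇑q ⬝ᵥ (fun _ => a) :=
        dotProduct_le_dotProduct_of_nonneg_left h (stdSimplex.zero_le q)
    _ = a := by simp only [dotProduct, ← Finset.sum_mul, stdSimplex.sum_eq_one, one_mul]

lemma continuous_dotProduct_stdSimplex (x : S → ℝ) :
    Continuous fun q : stdSimplex ℝ S => ⇑q ⬝ᵥ x :=
  continuous_subtype_val.dotProduct continuous_const

variable {γ : ℝ} (hγ₀ : 0 ≤ γ) (hγ₁ : γ < 1) (τ : S → stdSimplex ℝ S)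

include hγ₀ hγ₁

lemma le_div_of_le_add_discounted {x : S → ℝ} {a : ℝ} (h : ∀ s, x s ≤ a + γ * (⇑(τ s) ⬝ᵥ x))
    (s : S) : x s ≤ a / (1 - γ) := by
  have : Nonempty S := ⟨s⟩
  obtain ⟨m, hm⟩ := Finite.exists_max x
  have hmean : γ * (⇑(τ m) ⬝ᵥ x) ≤ γ * x m :=
    mul_le_mul_of_nonneg_left (dotProduct_le_of_forall_le (τ m) hm) hγ₀
  have hmax : x m ≤ a / (1 - γ) := by
    rw [le_div_iff₀ (sub_pos.2 hγ₁)]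
    linarith [h m]
  exact (hm s).trans hmax

lemma nonpos_of_le_discounted {x : S → ℝ} (h : ∀ s, x s ≤ γ * (⇑(τ s) ⬝ᵥ x)) (s : S) :
    x s ≤ 0 := by
  simpa using le_div_of_le_add_discounted hγ₀ hγ₁ τ (a := 0) (by simpa using h) s

lemma le_of_sub_le_discounted {x y : S → ℝ}
    (h : ∀ s, x s - y s ≤ γ * (⇑(τ s) ⬝ᵥ x) - γ * (⇑(τ s) ⬝ᵥ y)) : x ≤ y := fun s =>
  sub_nonpos.1 <| nonpos_of_le_discounted hγ₀ hγ₁ τ (x := x - y)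
    (fun s => by rw [dotProduct_sub, mul_sub]; exact h s) s

end StochasticVector

namespace RMC

open scoped Matrix

variable {S : Type*} [Fintype S]

section Evaluation

variable [DecidableEq S]

lemma one_sub_smul_mulVec_apply (γ : ℝ) (τ : S → stdSimplex ℝ S) (x : S → ℝ) (s : S) :
    (((1 : Matrix S S ℝ) - γ • Matrix.of fun s s' => τ s s') *ᵥ x) s =
      x s - γ * (⇑(τ s) ⬝ᵥ x) := by
  rw [Matrix.sub_mulVec, Matrix.one_mulVec, Matrix.smul_mulVec]
  rfl

variable (M : RMC S) {γ : ℝ} (hγ₀ : 0 ≤ γ) (hγ₁ : γ < 1) (τ : S → stdSimplex ℝ S)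

include hγ₀ hγ₁

lemma isUnit_one_sub_smul :
    IsUnit ((1 : Matrix S S ℝ) - γ • Matrix.of fun s s' => τ s s') := by
  refine Matrix.mulVec_injective_iff_isUnit.1 fun x y hxy => ?_
  have h : ∀ s, x s - γ * (⇑(τ s) ⬝ᵥ x) = y s - γ * (⇑(τ s) ⬝ᵥ y) := fun s => by
    simpa only [one_sub_smul_mulVec_apply] using congrFun hxy s
  exact le_antisymm (le_of_sub_le_discounted hγ₀ hγ₁ τ fun s => by linarith [h s])
    (le_of_sub_le_discounted hγ₀ hγ₁ τ fun s => by linarith [h s])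

lemma policyEval_apply (s : S) :
    M.policyEval γ τ s = M.cost s + γ * (⇑(τ s) ⬝ᵥ M.policyEval γ τ) := by
  have h : ((1 : Matrix S S ℝ) - γ • Matrix.of fun s s' => τ s s') *ᵥ M.policyEval γ τ =
      M.cost := by
    rw [policyEval, Matrix.mulVec_mulVec, Matrix.mul_nonsing_inv _
      ((Matrix.isUnit_iff_isUnit_det _).1 (isUnit_one_sub_smul hγ₀ hγ₁ τ)), Matrix.one_mulVec]
  have hs := congrFun h s
  rw [one_sub_smul_mulVec_apply] at hs
  linarith

lemma policyEval_le_of_supersolution {x : S → ℝ}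
    (h : ∀ s, M.cost s + γ * (⇑(τ s) ⬝ᵥ x) ≤ x s) : M.policyEval γ τ ≤ x :=
  le_of_sub_le_discounted hγ₀ hγ₁ τ fun s => by
    linarith [h s, M.policyEval_apply hγ₀ hγ₁ τ s]

lemma le_policyEval_of_subsolution {x : S → ℝ}
    (h : ∀ s, x s ≤ M.cost s + γ * (⇑(τ s) ⬝ᵥ x)) : x ≤ M.policyEval γ τ :=
  le_of_sub_le_discounted hγ₀ hγ₁ τ fun s => by
    linarith [h s, M.policyEval_apply hγ₀ hγ₁ τ s]

lemma eq_policyEval {x : S → ℝ} (h : ∀ s, x s = M.cost s + γ * (⇑(τ s) ⬝ᵥ x)) :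
    x = M.policyEval γ τ :=
  le_antisymm (M.le_policyEval_of_subsolution hγ₀ hγ₁ τ fun s => (h s).le)
    (M.policyEval_le_of_supersolution hγ₀ hγ₁ τ fun s => (h s).ge)

end Evaluation

section Greedy

lemma IsImprovement.isPolicy {M : RMC S} {γ : ℝ} {v : S → ℝ} {τ : S → stdSimplex ℝ S}
    (h : M.IsImprovement γ v τ) : M.IsPolicy τ := fun s => (h s).1

lemma IsImprovement.discounted_dotProduct_le {M : RMC S} {γ : ℝ} {v : S → ℝ}
    {τ : S → stdSimplex ℝ S} (h : M.IsImprovement γ v τ) {s : S} {q : stdSimplex ℝ S}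
    (hq : q ∈ M.uncertainty s) : γ * (⇑q ⬝ᵥ v) ≤ γ * (⇑(τ s) ⬝ᵥ v) :=
  le_of_add_le_add_left ((h s).2 q hq)

variable (M : RMC S) {γ : ℝ} (hγ₀ : 0 ≤ γ)

include hγ₀

lemma exists_isImprovement (v : S → ℝ) : ∃ τ, M.IsImprovement γ v τ := by
  choose τ hτ hmax using fun s => (M.isCompact s).exists_isMaxOn (M.nonempty s)
    (continuous_dotProduct_stdSimplex v).continuousOn
  exact ⟨τ, fun s => ⟨hτ s, fun q hq =>
    add_le_add_right (mul_le_mul_of_nonneg_left (hmax s hq) hγ₀) _⟩⟩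

variable [DecidableEq S] (hγ₁ : γ < 1)

include hγ₁

/- The Bellman operator is a `γ`-contraction; a policy that is greedy for its fixed point has that
fixed point as its evaluation. -/
lemma exists_isImprovement_policyEval_self :
    ∃ σ, M.IsImprovement γ (M.policyEval γ σ) σ := by
  choose g hg using M.exists_isImprovement hγ₀
  let T : (S → ℝ) → S → ℝ := fun v s => M.cost s + γ * (⇑(g v s) ⬝ᵥ v)
  have hsub : ∀ v w s, T v s - T w s ≤ γ * dist v w := fun v w s =>
    calc T v s - T w s ≤ γ * (⇑(g v s) ⬝ᵥ v) - γ * (⇑(g v s) ⬝ᵥ w) := by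
          linarith [(hg w).discounted_dotProduct_le ((hg v).isPolicy s)]
      _ = γ * (⇑(g v s) ⬝ᵥ (v - w)) := by rw [dotProduct_sub, mul_sub]
      _ ≤ γ * dist v w := mul_le_mul_of_nonneg_left (dotProduct_le_of_forall_le _ fun s' =>
          (le_abs_self _).trans (dist_le_pi_dist v w s')) hγ₀
  have hT : ContractingWith ⟨γ, hγ₀⟩ T := by
    refine ⟨hγ₁, LipschitzWith.of_dist_le_mul fun v w => (dist_pi_le_iff ?_).2 fun s => ?_⟩
    · exact mul_nonneg hγ₀ dist_nonneg
    · exact abs_sub_le_iff.2 ⟨hsub v w s, (hsub w v s).trans_eq (by rw [dist_comm]; rfl)⟩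
  have hfix : hT.fixedPoint T = M.policyEval γ (g (hT.fixedPoint T)) :=
    M.eq_policyEval hγ₀ hγ₁ _ fun s => (congrFun hT.fixedPoint_isFixedPt s).symm
  exact ⟨g (hT.fixedPoint T), hfix ▸ hg (hT.fixedPoint T)⟩

variable {M} in
lemma IsImprovement.policyEval_le {σ τ : S → stdSimplex ℝ S}
    (hσ : M.IsImprovement γ (M.policyEval γ σ) σ) (hτ : M.IsPolicy τ) :
    M.policyEval γ τ ≤ M.policyEval γ σ :=
  M.policyEval_le_of_supersolution hγ₀ hγ₁ τ fun s => by
    rw [M.policyEval_apply hγ₀ hγ₁ σ s]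
    exact (hσ s).2 _ (hτ s)

end Greedy

end RMC

section RunMeasure

open scoped Matrix

variable {S : Type*} [Fintype S] [MeasurableSpace S] [DiscreteMeasurableSpace S]

lemma integral_stepMeasure (q : stdSimplex ℝ S) (f : S → ℝ) :
    ∫ s, f s ∂stepMeasure q = ⇑q ⬝ᵥ f := by
  rw [stepMeasure, integral_finsetSum_measure fun s _ =>
    (integrable_dirac (by simp)).smul_measure ENNReal.ofReal_ne_top]
  refine Finset.sum_congr rfl fun s _ => ?_
  rw [integral_smul_measure, integral_dirac, ENNReal.toReal_ofReal (stdSimplex.zero_le q s),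
    smul_eq_mul]

instance (τ : S → stdSimplex ℝ S) (s₀ : S) : IsProbabilityMeasure (runMeasure τ s₀) := by
  unfold runMeasure
  infer_instance

variable (τ : S → stdSimplex ℝ S) (s₀ : S)

omit [Fintype S] in
lemma stronglyMeasurable_comp_eval (f : S → ℝ) (t : ℕ) :
    StronglyMeasurable fun ω : ℕ → S => f (ω t) :=
  ((Measurable.of_discrete (f := f)).comp (measurable_pi_apply t)).stronglyMeasurable

lemma integrable_comp_eval (f : S → ℝ) (t : ℕ) :
    Integrable (fun ω : ℕ → S => f (ω t)) (runMeasure τ s₀) := by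
  obtain ⟨b, hb⟩ := (Set.finite_range fun s => ‖f s‖).bddAbove
  exact .of_bound (stronglyMeasurable_comp_eval f t).aestronglyMeasurable b
    (Filter.Eventually.of_forall fun ω => hb ⟨ω t, rfl⟩)

lemma integral_eval_zero (f : S → ℝ) : ∫ ω, f (ω 0) ∂runMeasure τ s₀ = f s₀ := by
  rw [runMeasure, Kernel.integral_traj _ (integrable_comp_eval τ s₀ f 0).aestronglyMeasurable]
  simp [Function.updateFinset]

lemma integral_traj_stepKernel_eval_succ (f : S → ℝ) (t : ℕ) (h : Finset.Iic t → S) :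
    ∫ ω, f (ω (t + 1)) ∂Kernel.traj (X := fun _ => S) (stepKernel τ) t h =
      ⇑(τ (h ⟨t, Finset.mem_Iic.2 le_rfl⟩)) ⬝ᵥ f := by
  rw [← integral_stepMeasure]
  change _ = ∫ s, f s ∂stepKernel τ t h
  rw [← Kernel.map_traj_succ_self (X := fun _ => S) (κ := stepKernel τ),
    Kernel.map_apply _ (measurable_pi_apply _),
    integral_map (measurable_pi_apply _).aemeasurable
      (Measurable.of_discrete (f := f)).aestronglyMeasurable]

lemma integral_eval_succ (f : S → ℝ) (t : ℕ) :
    ∫ ω, f (ω (t + 1)) ∂runMeasure τ s₀ = ∫ ω, ⇑(τ (ω t)) ⬝ᵥ f ∂runMeasure τ s₀ := by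
  have hint := integrable_comp_eval τ s₀ f (t + 1)
  unfold runMeasure at hint ⊢
  rw [← Kernel.integral_traj_partialTraj (Nat.zero_le t) hint]
  simp_rw [integral_traj_stepKernel_eval_succ]
  rw [← Kernel.traj_map_frestrictLe_apply, integral_map]
  · rfl
  · exact (Preorder.measurable_frestrictLe t).aemeasurable
  · exact (Measurable.of_discrete (f := fun s : S => ⇑(τ s) ⬝ᵥ f)).comp
      (measurable_pi_apply _) |>.aestronglyMeasurable

variable {γ : ℝ} (hγ₀ : 0 ≤ γ) (hγ₁ : γ < 1)

include hγ₀ hγ₁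

lemma hasSum_integral_discounted (f : S → ℝ) :
    HasSum (fun t : ℕ => γ ^ t * ∫ ω, f (ω t) ∂runMeasure τ s₀)
      (∫ ω, ∑' t : ℕ, γ ^ t * f (ω t) ∂runMeasure τ s₀) := by
  obtain ⟨b, hb⟩ := (Set.finite_range fun s => |f s|).bddAbove
  have hnorm : ∀ t, ∫ ω, ‖γ ^ t * f (ω t)‖ ∂runMeasure τ s₀ ≤ γ ^ t * b := fun t =>
    calc ∫ ω, ‖γ ^ t * f (ω t)‖ ∂runMeasure τ s₀ ≤ ∫ _, γ ^ t * b ∂runMeasure τ s₀ := by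
          refine integral_mono ((integrable_comp_eval τ s₀ f t).const_mul _).norm
            (integrable_const _) fun ω => ?_
          rw [norm_mul, norm_pow, Real.norm_of_nonneg hγ₀]
          exact mul_le_mul_of_nonneg_left (hb ⟨ω t, rfl⟩) (pow_nonneg hγ₀ t)
      _ = γ ^ t * b := by simp
  simpa only [integral_const_mul] using hasSum_integral_of_summable_integral_norm
    (fun t => (integrable_comp_eval τ s₀ f t).const_mul (γ ^ t))
    (.of_nonneg_of_le (fun t => by positivity) hnorm
      ((summable_geometric_of_lt_one hγ₀ hγ₁).mul_right b))

/- The expected cost at time `t` is `γ ^ t * a t - γ ^ (t + 1) * a (t + 1)`, where `a t` is the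
expectation of `v` at time `t`, so the discounted series telescopes. -/
lemma integral_tsum_discounted {c v : S → ℝ} (h : ∀ s, v s = c s + γ * (⇑(τ s) ⬝ᵥ v)) :
    ∫ ω, ∑' t : ℕ, γ ^ t * c (ω t) ∂runMeasure τ s₀ = v s₀ := by
  let a : ℕ → ℝ := fun t => ∫ ω, v (ω t) ∂runMeasure τ s₀
  have hcost : ∀ t, ∫ ω, c (ω t) ∂runMeasure τ s₀ = a t - γ * a (t + 1) := fun t => by
    simp only [a, integral_eval_succ]
    rw [← integral_const_mul, ← integral_sub (integrable_comp_eval τ s₀ v t)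
      ((integrable_comp_eval τ s₀ (fun s => ⇑(τ s) ⬝ᵥ v) t).const_mul γ)]
    exact integral_congr_ae (.of_forall fun ω => eq_sub_of_add_eq (h (ω t)).symm)
  have hv := hasSum_integral_discounted τ s₀ hγ₀ hγ₁ v
  have hdiff := hv.sub ((hasSum_nat_add_iff' 1).2 hv)
  have hterm : (fun t => γ ^ t * ∫ ω, c (ω t) ∂runMeasure τ s₀) =
      fun t => γ ^ t * a t - γ ^ (t + 1) * a (t + 1) := by
    funext t
    rw [hcost]
    ring
  rw [(hasSum_integral_discounted τ s₀ hγ₀ hγ₁ c).unique (hterm ▸ hdiff)]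
  simp [integral_eval_zero]

end RunMeasure

namespace RMC

variable {S : Type*} [Fintype S] [DecidableEq S] (M : RMC S) {γ : ℝ} (hγ₀ : 0 ≤ γ) (hγ₁ : γ < 1)

include hγ₀ hγ₁

lemma expectedCost_eq_policyEval (τ : S → stdSimplex ℝ S) :
    expectedCost γ M.cost τ = M.policyEval γ τ := by
  funext s
  let _ : MeasurableSpace S := ⊤
  have : DiscreteMeasurableSpace S := ⟨fun _ => trivial⟩
  exact integral_tsum_discounted τ s hγ₀ hγ₁ (M.policyEval_apply hγ₀ hγ₁ τ)

variable {M} in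
lemma IsImprovement.policyEval_eq_value {σ : S → stdSimplex ℝ S}
    (hσ : M.IsImprovement γ (M.policyEval γ σ) σ) : M.policyEval γ σ = M.value γ := by
  funext s
  have : Nonempty {τ // M.IsPolicy τ} := ⟨⟨σ, hσ.isPolicy⟩⟩
  have hle : ∀ τ : {τ // M.IsPolicy τ}, expectedCost γ M.cost τ.1 s ≤ M.policyEval γ σ s :=
    fun τ => M.expectedCost_eq_policyEval hγ₀ hγ₁ τ.1 ▸ hσ.policyEval_le hγ₀ hγ₁ τ.2 s
  refine le_antisymm ?_ (ciSup_le hle)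
  rw [← M.expectedCost_eq_policyEval hγ₀ hγ₁]
  exact le_ciSup (f := fun τ : {τ // M.IsPolicy τ} => expectedCost γ M.cost τ.1 s)
    ⟨_, Set.forall_mem_range.2 hle⟩ ⟨σ, hσ.isPolicy⟩

variable {M} in
lemma IsPolicy.policyEval_le_value {τ : S → stdSimplex ℝ S} (hτ : M.IsPolicy τ) :
    M.policyEval γ τ ≤ M.value γ := by
  obtain ⟨σ, hσ⟩ := M.exists_isImprovement_policyEval_self hγ₀ hγ₁
  exact hσ.policyEval_eq_value hγ₀ hγ₁ ▸ hσ.policyEval_le hγ₀ hγ₁ hτ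

lemma isOptimal_iff_policyEval_eq {τ : S → stdSimplex ℝ S} :
    M.IsOptimal γ τ ↔ M.IsPolicy τ ∧ M.policyEval γ τ = M.value γ := by
  rw [IsOptimal, M.expectedCost_eq_policyEval hγ₀ hγ₁, funext_iff]

end RMC

section Halving

open scoped Matrix

lemma sum_range_succ_add_le_of_halving {y : ℕ → ℝ} (h : ∀ j, 2 * y (j + 1) ≤ y j) (m : ℕ) :
    ∑ j ∈ Finset.range m, y (j + 1) + y m ≤ y 0 := by
  induction m with
  | zero => simp
  | succ m ih =>
    rw [Finset.sum_range_succ]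
    linarith [h m]

/- The leading nonzero term would outweigh all later ones. -/
lemma eq_zero_of_sum_mul_eq_zero_of_halving {y : ℕ → ℝ} {e : ℕ → ℤ} {m : ℕ}
    (hpos : ∀ j < m, 0 < y j) (h : ∀ j, 2 * y (j + 1) ≤ y j) (he : ∀ j < m, |e j| ≤ 1)
    (hsum : ∑ j ∈ Finset.range m, e j * y j = 0) : ∀ j < m, e j = 0 := by
  induction m generalizing y e with
  | zero => simp
  | succ m ih =>
    rw [Finset.sum_range_succ'] at hsum
    have htail : |∑ j ∈ Finset.range m, e (j + 1) * y (j + 1)| < y 0 :=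
      calc |∑ j ∈ Finset.range m, e (j + 1) * y (j + 1)|
          ≤ ∑ j ∈ Finset.range m, |e (j + 1) * y (j + 1)| := Finset.abs_sum_le_sum_abs _ _
        _ ≤ ∑ j ∈ Finset.range m, y (j + 1) := by
          refine Finset.sum_le_sum fun j hj => ?_
          have hj' : j + 1 < m + 1 := Nat.succ_lt_succ (Finset.mem_range.1 hj)
          rw [abs_mul, abs_of_pos (hpos _ hj')]
          exact mul_le_of_le_one_left (hpos _ hj').le (mod_cast he _ hj')
        _ < y 0 := by linarith [sum_range_succ_add_le_of_halving h m, hpos m m.lt_succ_self]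
    have hzero : e 0 = 0 := by
      by_contra hne
      have hone : (1 : ℝ) ≤ |(e 0 : ℝ)| := mod_cast Int.one_le_abs hne
      rw [eq_neg_of_add_eq_zero_left hsum, abs_neg, abs_mul, abs_of_pos (hpos 0 m.succ_pos)]
        at htail
      exact htail.not_ge (le_mul_of_one_le_left (hpos 0 m.succ_pos).le hone)
    rw [hzero, Int.cast_zero, zero_mul, add_zero] at hsum
    intro j hj
    rcases j with _ | j
    · exact hzero
    · exact ih (fun j hj => hpos _ (Nat.succ_lt_succ hj)) (fun j => h (j + 1))
        (fun j hj => he _ (Nat.succ_lt_succ hj)) hsum j (Nat.lt_of_succ_lt_succ hj)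

open scoped Matrix.Norms.Elementwise in
lemma exists_ne_zero_mulVec_eq_zero_of_abs_le_one {α β : Type*} [Fintype α] [Fintype β]
    [Nonempty α] [Nonempty β] (A : Matrix α β ℤ) (hA : ∀ i j, |A i j| ≤ 1)
    (hcard : (2 * Fintype.card β) ^ Fintype.card α < 2 ^ Fintype.card β) :
    ∃ t : β → ℤ, t ≠ 0 ∧ A *ᵥ t = 0 ∧ ∀ j, |t j| ≤ 1 := by
  have hβ : 1 ≤ Fintype.card β := Fintype.card_pos
  have hlt : Fintype.card α < Fintype.card β :=
    (Nat.pow_lt_pow_iff_right one_lt_two).1 <|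
      (Nat.pow_le_pow_left (show 2 ≤ 2 * Fintype.card β by lia) _).trans_lt hcard
  obtain ⟨t, ht, hAt, hnorm⟩ := Int.Matrix.exists_ne_zero_int_vec_norm_le A hlt Fintype.card_pos
  have hnormA : max 1 ‖A‖ = 1 := max_eq_left <|
    (Matrix.norm_le_iff zero_le_one).2 fun i j => by
      rw [Int.norm_eq_abs]
      exact_mod_cast hA i j
  set a := Fintype.card α
  set b := Fintype.card β
  have hab : (0 : ℝ) < b - a := sub_pos.2 (mod_cast hlt)
  have hpow : (b : ℝ) ^ a < 2 ^ (b - a : ℝ) := by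
    rw [Real.rpow_sub two_pos, Real.rpow_natCast, Real.rpow_natCast,
      lt_div_iff₀ (by positivity), ← mul_pow, mul_comm]
    exact_mod_cast hcard
  have hlt_two : ‖t‖ < 2 :=
    calc ‖t‖ ≤ (b : ℝ) ^ ((a : ℝ) / (b - a)) := by rwa [hnormA, mul_one] at hnorm
      _ = ((b : ℝ) ^ a) ^ (1 / (b - a : ℝ)) := by
        rw [← Real.rpow_natCast, ← Real.rpow_mul b.cast_nonneg, mul_one_div]
      _ < (2 ^ (b - a : ℝ)) ^ (1 / (b - a : ℝ)) :=
        Real.rpow_lt_rpow (by positivity) hpow (one_div_pos.2 hab)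
      _ = 2 := by rw [← Real.rpow_mul two_pos.le, mul_one_div_cancel hab.ne', Real.rpow_one]
  refine ⟨t, ht, hAt, fun j => Int.lt_add_one_iff.1 ?_⟩
  have := (norm_le_pi_norm t j).trans_lt hlt_two
  rw [Int.norm_eq_abs] at this
  exact_mod_cast this

lemma exists_nonpos_of_halving {ι : Type*} [Fintype ι] [Nonempty ι] {y : ℕ → ℝ} {m : ℕ}
    (h : ∀ j, 2 * y (j + 1) ≤ y j) (x : ι → ℝ) {c : ℕ → ι → ℤ} (hc : ∀ j i, |c j i| ≤ 1)
    (hy : ∀ j, y j = ∑ i, c j i * x i) (hm : m ≠ 0)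
    (hcard : (2 * m) ^ Fintype.card ι < 2 ^ m) :
    ∃ j < m, y j ≤ 0 := by
  by_contra! hpos
  have : Nonempty (Fin m) := ⟨0, Nat.pos_of_ne_zero hm⟩
  obtain ⟨t, ht, hAt, ht_le⟩ := exists_ne_zero_mulVec_eq_zero_of_abs_le_one
    (.of fun i (j : Fin m) => c j i) (fun i j => hc j i) (by simpa using hcard)
  let e : ℕ → ℤ := fun j => if hj : j < m then t ⟨j, hj⟩ else 0
  have he : ∀ j : Fin m, e j = t j := fun j => dif_pos j.2
  have hsum : ∑ j ∈ Finset.range m, e j * y j = 0 :=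
    calc ∑ j ∈ Finset.range m, e j * y j = ∑ j : Fin m, t j * ∑ i, c j i * x i := by
          simp only [Finset.sum_range, he, hy]
      _ = ∑ i, ((∑ j : Fin m, c j i * t j : ℤ) : ℝ) * x i := by
          push_cast
          simp only [Finset.mul_sum, Finset.sum_mul]
          rw [Finset.sum_comm]
          exact Finset.sum_congr rfl fun i _ => Finset.sum_congr rfl fun j _ => by ring
      _ = 0 := Finset.sum_eq_zero fun i _ => by
          rw [show ∑ j : Fin m, c j i * t j = 0 from congrFun hAt i, Int.cast_zero, zero_mul]
  refine ht (funext fun j => (he j).symm.trans ?_)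
  exact eq_zero_of_sum_mul_eq_zero_of_halving hpos h
    (fun j hj => by simpa only [e, dif_pos hj] using ht_le ⟨j, hj⟩) hsum j j.2

lemma two_mul_pow_lt_two_pow {c k : ℕ} (hk : 1 ≤ k) (hc : c ≠ 0) (hck : c ≤ 2 ^ (3 * k + 2)) :
    (2 * (12 * c * k)) ^ c < 2 ^ (12 * c * k) := by
  rw [show 12 * c * k = 12 * k * c by ring, pow_mul]
  refine Nat.pow_lt_pow_left ?_ hc
  calc 2 * (12 * k * c) ≤ 2 * (16 * 2 ^ k * 2 ^ (3 * k + 2)) := by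
        gcongr
        · norm_num
        · exact Nat.lt_two_pow_self.le
    _ = 2 ^ (4 * k + 7) := by ring
    _ < 2 ^ (12 * k) := Nat.pow_lt_pow_right one_lt_two (by lia)

end Halving

section ExtremePoints

open Filter Topology
open scoped Matrix

/- The maximizers of `f` form a compact exposed face, and so do the minimizers of `g` on it. -/
lemma exists_mem_extremePoints_of_isMaxOn {E : Type*} [AddCommGroup E] [Module ℝ E]
    [TopologicalSpace E] [T2Space E] [IsTopologicalAddGroup E] [ContinuousSMul ℝ E]
    [LocallyConvexSpace ℝ E] {K : Set E} (hK : IsCompact K) (f g : StrongDual ℝ E) {p : E}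
    (hp : p ∈ K) (hmax : ∀ q ∈ K, f q ≤ f p) :
    ∃ q ∈ K.extremePoints ℝ, f p ≤ f q ∧ g q ≤ g p := by
  have hF : IsExposed ℝ K (f.toExposed K) := ContinuousLinearMap.toExposed.isExposed
  have hG : IsExposed ℝ (f.toExposed K) ((-g).toExposed (f.toExposed K)) :=
    ContinuousLinearMap.toExposed.isExposed
  have hFc : IsCompact (f.toExposed K) := hF.isCompact hK
  have hGne : ((-g).toExposed (f.toExposed K)).Nonempty :=
    hFc.exists_isMaxOn ⟨p, hp, hmax⟩ (-g).continuous.continuousOn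
  obtain ⟨q, hq⟩ := (hG.isCompact hFc).extremePoints_nonempty hGne
  refine ⟨q, (hF.isExtreme.trans hG.isExtreme).extremePoints_subset_extremePoints hq,
    hq.1.1.2 p hp, ?_⟩
  simpa using hq.1.2 p ⟨hp, hmax⟩

lemma eq_zero_of_eventually_add_smul_mem {E : Type*} [AddCommGroup E] [Module ℝ E] {K : Set E}
    {q d : E} (hq : q ∈ K.extremePoints ℝ) (h : ∀ᶠ ε in 𝓝 (0 : ℝ), q + ε • d ∈ K) : d = 0 := by
  obtain ⟨ε₀, hε₀, hball⟩ := Metric.eventually_nhds_iff.1 h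
  have hε : ε₀ / 2 ≠ 0 := (half_pos hε₀).ne'
  have hmem : ∀ e : ℝ, |e| = ε₀ / 2 → q + e • d ∈ K := fun e he =>
    hball (by rw [Real.dist_eq, sub_zero, he]; exact half_lt_self hε₀)
  have hseg : q ∈ openSegment ℝ (q + (ε₀ / 2) • d) (q + (-(ε₀ / 2)) • d) :=
    ⟨1 / 2, 1 / 2, by norm_num, by norm_num, by norm_num, by module⟩
  have hfix : q + (ε₀ / 2) • d = q :=
    ((mem_extremePoints.1 hq).2 _ (hmem _ (abs_of_pos (half_pos hε₀)))
      _ (hmem _ (by rw [abs_neg, abs_of_pos (half_pos hε₀)])) hseg).1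
  exact (smul_eq_zero.1 (left_eq_add.1 hfix.symm)).resolve_left hε

variable {S : Type*} [Fintype S]

/-- The extreme points of a set of probability vectors, viewed as a set in `S → ℝ`. -/
def vertices (U : Set (stdSimplex ℝ S)) : Set (stdSimplex ℝ S) :=
  {q | ⇑q ∈ Set.extremePoints ℝ ((fun r : stdSimplex ℝ S => ⇑r) '' U)}

lemma vertices_subset (U : Set (stdSimplex ℝ S)) : vertices U ⊆ U := fun _ hq => by
  obtain ⟨r, hr, hrq⟩ := extremePoints_subset hq
  exact stdSimplex.ext hrq ▸ hr

lemma exists_mem_vertices_of_isMaxOn {U : Set (stdSimplex ℝ S)} (hU : IsCompact U) (x y : S → ℝ)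
    {p : stdSimplex ℝ S} (hp : p ∈ U) (hmax : ∀ q ∈ U, ⇑q ⬝ᵥ x ≤ ⇑p ⬝ᵥ x) :
    ∃ q ∈ vertices U, ⇑p ⬝ᵥ x ≤ ⇑q ⬝ᵥ x ∧ ⇑q ⬝ᵥ y ≤ ⇑p ⬝ᵥ y := by
  let f (z : S → ℝ) : StrongDual ℝ (S → ℝ) := ((dotProductBilin ℝ ℝ).flip z).toContinuousLinearMap
  obtain ⟨q, hq, hx, hy⟩ := exists_mem_extremePoints_of_isMaxOn
    (hU.image continuous_subtype_val) (f x) (f y) (Set.mem_image_of_mem _ hp)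
    (Set.forall_mem_image.2 hmax)
  obtain ⟨r, -, rfl⟩ := extremePoints_subset hq
  exact ⟨r, hq, hx, hy⟩

/-- The probability vectors supported on `A` at `L_p` distance at most `δ` from `r`. -/
def lpBall (p : ℝ≥0∞) (A : Set S) (r : stdSimplex ℝ S) (δ : ℝ) : Set (stdSimplex ℝ S) :=
  {q | (∀ s ∉ A, q s = 0) ∧
    ‖(WithLp.toLp p (fun s => q s - r s) : PiLp p fun _ : S => ℝ)‖ ≤ δ}

lemma mem_lpBall_one {A : Set S} {r q : stdSimplex ℝ S} {δ : ℝ} :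
    q ∈ lpBall 1 A r δ ↔ (∀ s ∉ A, q s = 0) ∧ ∑ s, |q s - r s| ≤ δ := by
  simp only [lpBall, Set.mem_ofPred_eq, PiLp.norm_eq_of_L1, Real.norm_eq_abs]

lemma mem_lpBall_top [Nonempty S] {A : Set S} {r q : stdSimplex ℝ S} {δ : ℝ} :
    q ∈ lpBall ⊤ A r δ ↔ (∀ s ∉ A, q s = 0) ∧ ∀ s, |q s - r s| ≤ δ := by
  simp only [lpBall, Set.mem_ofPred_eq, PiLp.norm_eq_ciSup, Real.norm_eq_abs,
    ciSup_le_iff (Set.finite_range _).bddAbove]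

lemma eventually_pos_add_mul {x : ℝ} (hx : 0 < x) (d : ℝ) : ∀ᶠ ε in 𝓝 (0 : ℝ), 0 < x + ε * d :=
  (Continuous.tendsto' (by fun_prop) _ _ (by simp)).eventually_const_lt hx

lemma eventually_add_smul_mem_stdSimplex (q : stdSimplex ℝ S) {d : S → ℝ}
    (hsum : ∑ s, d s = 0) (hd : ∀ s, q s = 0 → d s = 0) :
    ∀ᶠ ε in 𝓝 (0 : ℝ), ⇑q + ε • d ∈ stdSimplex ℝ S := by
  have hnonneg : ∀ s, ∀ᶠ ε in 𝓝 (0 : ℝ), 0 ≤ q s + ε * d s := fun s => by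
    rcases (stdSimplex.zero_le q s).eq_or_lt with h | h
    · simp [← h, hd s h.symm]
    · exact (eventually_pos_add_mul h (d s)).mono fun _ => le_of_lt
  filter_upwards [eventually_all.2 hnonneg] with ε hε
  refine ⟨hε, ?_⟩
  simp [Finset.sum_add_distrib, ← Finset.mul_sum, hsum]

/- Otherwise mass could be moved in both directions between `i` and `j`. -/
lemma eq_of_mem_vertices_of_eventually_mem [DecidableEq S] {U : Set (stdSimplex ℝ S)}
    {q : stdSimplex ℝ S} (hq : q ∈ vertices U) {i j : S} (hi : 0 < q i) (hj : 0 < q j)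
    (h : ∀ᶠ ε in 𝓝 (0 : ℝ), ∀ q' : stdSimplex ℝ S,
      (∀ s, q' s = q s + ε * (Pi.single i 1 - Pi.single j 1 : S → ℝ) s) → q' ∈ U) : i = j := by
  set d : S → ℝ := Pi.single i 1 - Pi.single j 1 with hd
  have hd_of_zero : ∀ s, q s = 0 → d s = 0 := fun s hs => by
    rw [hd, Pi.sub_apply, Pi.single_eq_of_ne, Pi.single_eq_of_ne, sub_zero]
    · rintro rfl; exact hj.ne' hs
    · rintro rfl; exact hi.ne' hs
  have hmem : ∀ᶠ ε in 𝓝 (0 : ℝ), ⇑q + ε • d ∈ (fun r : stdSimplex ℝ S => ⇑r) '' U := by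
    filter_upwards [eventually_add_smul_mem_stdSimplex q (by simp [d]) hd_of_zero, h] with ε hε hU
    exact ⟨⟨_, hε⟩, hU _ fun s => rfl, rfl⟩
  by_contra hij
  have := congrFun (eq_zero_of_eventually_add_smul_mem hq hmem) i
  simp [d, hij] at this

lemma eventually_abs_add_mul_eq {x d : ℝ} (h : x = 0 → d = 0) :
    ∀ᶠ ε in 𝓝 (0 : ℝ), |x + ε * d| = |x| + ε * (d * (SignType.sign x : ℝ)) := by
  rcases lt_trichotomy x 0 with hx | rfl | hx
  · filter_upwards [eventually_pos_add_mul (neg_pos.2 hx) (-d)] with ε hε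
    rw [sign_neg hx, abs_of_neg hx, abs_of_neg (by linarith)]
    simp
    ring
  · simp [h rfl]
  · filter_upwards [eventually_pos_add_mul hx d] with ε hε
    rw [sign_pos hx, abs_of_pos hx, abs_of_pos hε]
    simp

end ExtremePoints

section BasicPoints

open Filter Topology
open scoped Matrix

variable {S : Type*} [Fintype S]

/-- Probability vectors with all but at most one coordinate in `{0, r i, r i + d, r i - d}`. Sums
over such a vector are integer combinations of few reals that depend on `r` and `d` only. -/
def IsBasicPoint (r : S → ℝ) (d : ℝ) (q : stdSimplex ℝ S) : Prop :=
  {i | q i ∉ ({0, r i, r i + d, r i - d} : Set ℝ)}.Subsingleton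

lemma eq_of_mem_vertices_lpBall [DecidableEq S] {p : ℝ≥0∞} {A : Set S} {r q : stdSimplex ℝ S}
    {δ : ℝ} (hq : q ∈ vertices (lpBall p A r δ)) {i j : S} (hi : 0 < q i) (hj : 0 < q j)
    (h : ∀ᶠ ε in 𝓝 (0 : ℝ), ‖(WithLp.toLp p (fun s => q s - r s +
      ε * (Pi.single i 1 - Pi.single j 1 : S → ℝ) s) : PiLp p fun _ : S => ℝ)‖ ≤ δ) : i = j := by
  refine eq_of_mem_vertices_of_eventually_mem hq hi hj ?_
  filter_upwards [h] with ε hε q' hq'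
  refine ⟨fun s hs => ?_, ?_⟩
  · have hqs := (vertices_subset _ hq).1 s hs
    have hsi : s ≠ i := by rintro rfl; exact hi.ne' hqs
    have hsj : s ≠ j := by rintro rfl; exact hj.ne' hqs
    simp [hq', hqs, hsi, hsj]
  · simpa only [hq', add_sub_right_comm] using hε

lemma isBasicPoint_of_mem_vertices_lpBall_top [Nonempty S] {A : Set S} {r q : stdSimplex ℝ S}
    {δ : ℝ} (hq : q ∈ vertices (lpBall ⊤ A r δ)) : IsBasicPoint r δ q := by
  classical
  have hle := (mem_lpBall_top.1 (vertices_subset _ hq)).2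
  have hinterior : ∀ i, q i ∉ ({0, r i, r i + δ, r i - δ} : Set ℝ) →
      0 < q i ∧ |q i - r i| < δ := fun i hi => by
    simp only [Set.mem_insert_iff, Set.mem_singleton_iff, not_or] at hi
    refine ⟨(stdSimplex.zero_le q i).lt_of_ne' hi.1, (hle i).lt_of_ne fun h => ?_⟩
    rcases abs_choice (q i - r i) with h' | h'
    · exact hi.2.2.1 (by linarith)
    · exact hi.2.2.2 (by linarith)
  intro i hi j hj
  refine eq_of_mem_vertices_lpBall hq (hinterior i hi).1 (hinterior j hj).1 ?_
  have hcoord : ∀ s, ∀ᶠ ε in 𝓝 (0 : ℝ),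
      |q s - r s + ε * (Pi.single i 1 - Pi.single j 1 : S → ℝ) s| ≤ δ := fun s => by
    by_cases hs : |q s - r s| < δ
    · refine (Tendsto.eventually_lt_const hs ?_).mono fun _ => le_of_lt
      exact Continuous.tendsto' (by fun_prop) _ _ (by simp)
    · have hsi : s ≠ i := by rintro rfl; exact hs (hinterior s hi).2
      have hsj : s ≠ j := by rintro rfl; exact hs (hinterior s hj).2
      simp [hsi, hsj, hle s]
  filter_upwards [eventually_all.2 hcoord] with ε hε
  rw [PiLp.norm_eq_ciSup]
  exact ciSup_le hε

lemma eq_of_mem_vertices_lpBall_one_of_lt {A : Set S} {r q : stdSimplex ℝ S} {δ : ℝ}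
    (hq : q ∈ vertices (lpBall 1 A r δ)) (hlt : ∑ s, |q s - r s| < δ) {i j : S} (hi : 0 < q i)
    (hj : 0 < q j) : i = j := by
  classical
  refine eq_of_mem_vertices_lpBall hq hi hj ?_
  simp only [PiLp.norm_eq_of_L1, Real.norm_eq_abs]
  refine (Tendsto.eventually_lt_const hlt ?_).mono fun _ => le_of_lt
  exact Continuous.tendsto' (by fun_prop) _ _ (by simp)

/- Moving mass between `i` and `j` changes two absolute values by opposite amounts. -/
lemma eq_of_mem_vertices_lpBall_one_of_sign_eq {A : Set S} {r q : stdSimplex ℝ S} {δ : ℝ}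
    (hq : q ∈ vertices (lpBall 1 A r δ)) {i j : S} (hi : 0 < q i) (hj : 0 < q j)
    (hne : q i ≠ r i) (hsign : SignType.sign (q i - r i) = SignType.sign (q j - r j)) :
    i = j := by
  classical
  have hine : q i - r i ≠ 0 := sub_ne_zero.2 hne
  have hjne : q j - r j ≠ 0 := by rwa [← sign_ne_zero, ← hsign, sign_ne_zero]
  refine eq_of_mem_vertices_lpBall hq hi hj ?_
  have habs := fun s => eventually_abs_add_mul_eq (x := q s - r s)
    (d := (Pi.single i 1 - Pi.single j 1 : S → ℝ) s) fun hs => by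
      have hsi : s ≠ i := by rintro rfl; exact hine hs
      have hsj : s ≠ j := by rintro rfl; exact hjne hs
      simp [hsi, hsj]
  filter_upwards [eventually_all.2 habs] with ε hε
  simp only [PiLp.norm_eq_of_L1, Real.norm_eq_abs, hε, Finset.sum_add_distrib, ← Finset.mul_sum]
  have hchange : ∑ s, (Pi.single i 1 - Pi.single j 1 : S → ℝ) s *
      (SignType.sign (q s - r s) : ℝ) = 0 := by
    simp [sub_mul, Finset.sum_sub_distrib, Pi.single_apply, hsign]
  rw [hchange, mul_zero, add_zero]
  exact (mem_lpBall_one.1 (vertices_subset _ hq)).2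

/- The upward and the downward deviations both sum to `δ / 2`, and `i` is the only upward one. -/
lemma eq_add_half_of_mem_vertices_lpBall_one {A : Set S} {r q : stdSimplex ℝ S} {δ : ℝ}
    (hq : q ∈ vertices (lpBall 1 A r δ)) (hsum : ∑ s, |q s - r s| = δ) {i : S}
    (hi : r i < q i) : q i = r i + δ / 2 := by
  have hdown : ∀ s ≠ i, q s ≤ r s := fun s hs => by
    by_contra! hlt
    refine hs (eq_of_mem_vertices_lpBall_one_of_sign_eq hq
      ((stdSimplex.zero_le r s).trans_lt hlt) ((stdSimplex.zero_le r i).trans_lt hi) hlt.ne' ?_)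
    rw [sign_pos (sub_pos.2 hlt), sign_pos (sub_pos.2 hi)]
  have hup : ∑ s, (|q s - r s| + (q s - r s)) = |q i - r i| + (q i - r i) :=
    Fintype.sum_eq_single i fun s hs => by
      rw [abs_of_nonpos (sub_nonpos.2 (hdown s hs)), neg_add_cancel]
  rw [Finset.sum_add_distrib, Finset.sum_sub_distrib, hsum, stdSimplex.sum_eq_one,
    stdSimplex.sum_eq_one, abs_of_pos (sub_pos.2 hi)] at hup
  linarith

lemma isBasicPoint_of_mem_vertices_lpBall_one {A : Set S} {r q : stdSimplex ℝ S} {δ : ℝ}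
    (hq : q ∈ vertices (lpBall 1 A r δ)) : IsBasicPoint r (δ / 2) q := by
  have hpos : ∀ i, q i ∉ ({0, r i, r i + δ / 2, r i - δ / 2} : Set ℝ) → 0 < q i := fun i hi =>
    (stdSimplex.zero_le q i).lt_of_ne' fun h => hi (Or.inl h)
  intro i hi j hj
  rcases (mem_lpBall_one.1 (vertices_subset _ hq)).2.lt_or_eq with hlt | heq
  · exact eq_of_mem_vertices_lpBall_one_of_lt hq hlt (hpos i hi) (hpos j hj)
  · have hlt : ∀ i, q i ∉ ({0, r i, r i + δ / 2, r i - δ / 2} : Set ℝ) → q i < r i :=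
      fun i hi => by
        simp only [Set.mem_insert_iff, Set.mem_singleton_iff, not_or] at hi
        exact (not_lt.1 (mt (eq_add_half_of_mem_vertices_lpBall_one hq heq) hi.2.2.1)).lt_of_ne
          hi.2.1
    refine eq_of_mem_vertices_lpBall_one_of_sign_eq hq (hpos i hi) (hpos j hj) (hlt i hi).ne ?_
    rw [sign_neg (sub_neg.2 (hlt i hi)), sign_neg (sub_neg.2 (hlt j hj))]

/-- The reals of which `X - q ⬝ᵥ x` is an integer combination when `q` is a basic point for `r`
and `d` and `k` is its exceptional coordinate; `k` is eliminated through `∑ i, q i = 1`. -/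
def basicTerms (r : S → ℝ) (d : ℝ) (k : S) (x : S → ℝ) (X : ℝ) : Option (S ⊕ S) → ℝ
  | none => X - x k
  | some (.inl i) => r i * (x i - x k)
  | some (.inr i) => d * (x i - x k)

lemma exists_abs_le_one_and_eq_mul_add_mul {r d a : ℝ}
    (ha : a ∈ ({0, r, r + d, r - d} : Set ℝ)) :
    ∃ m n : ℤ, |m| ≤ 1 ∧ |n| ≤ 1 ∧ a = m * r + n * d := by
  rcases ha with rfl | rfl | rfl | rfl
  · exact ⟨0, 0, by simp⟩
  · exact ⟨1, 0, by simp⟩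
  · exact ⟨1, 1, by simp⟩
  · exact ⟨1, -1, by simp [sub_eq_add_neg]⟩

lemma dotProduct_eq_add_sum_sub (q : stdSimplex ℝ S) (x : S → ℝ) (k : S) :
    ⇑q ⬝ᵥ x = x k + ∑ i, q i * (x i - x k) := by
  simp [dotProduct, mul_sub, Finset.sum_sub_distrib, ← Finset.sum_mul]

lemma IsBasicPoint.exists_sub_dotProduct_eq [Nonempty S] {r : S → ℝ} {d : ℝ}
    {q : stdSimplex ℝ S} (hq : IsBasicPoint r d q) :
    ∃ (k : S) (c : Option (S ⊕ S) → ℤ), (∀ o, |c o| ≤ 1) ∧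
      ∀ x X, X - ⇑q ⬝ᵥ x = ∑ o, c o * basicTerms r d k x X o := by
  obtain ⟨k, hk⟩ : ∃ k, ∀ i ≠ k, q i ∈ ({0, r i, r i + d, r i - d} : Set ℝ) := by
    rcases hq.eq_empty_or_singleton with h | ⟨k, h⟩
    · exact ⟨Classical.arbitrary S, fun i _ => not_not.1 (Set.eq_empty_iff_forall_notMem.1 h i)⟩
    · exact ⟨k, fun i => not_imp_comm.1 fun hi => Set.mem_singleton_iff.1 (h ▸ hi)⟩
  have hcoeff : ∀ i, ∃ a b : ℤ, |a| ≤ 1 ∧ |b| ≤ 1 ∧ (i ≠ k → q i = a * r i + b * d) := fun i => by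
    by_cases hik : i = k
    · exact ⟨0, 0, by simp [hik]⟩
    · obtain ⟨a, b, ha, hb, h⟩ := exists_abs_le_one_and_eq_mul_add_mul (hk i hik)
      exact ⟨a, b, ha, hb, fun _ => h⟩
  choose a b ha hb hab using hcoeff
  refine ⟨k, fun o => o.elim 1 (Sum.elim (-a) (-b)), ?_, fun x X => ?_⟩
  · rintro (_ | i | i) <;> simp [ha, hb]
  · have hterm : ∀ i, q i * (x i - x k) = a i * (r i * (x i - x k)) + b i * (d * (x i - x k)) :=
      fun i => by
        rcases eq_or_ne i k with rfl | hik
        · simp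
        · rw [hab i hik]
          ring
    rw [dotProduct_eq_add_sum_sub q x k, Finset.sum_congr rfl fun i _ => hterm i,
      Finset.sum_add_distrib, Fintype.sum_option, Fintype.sum_sum_type]
    simp [basicTerms]
    ring

namespace RMC

/-- The vertices of each uncertainty set are basic points with common parameters. This is all
that the iteration bound uses of `L_1` and `L_∞` uncertainty. -/
def HasBasicVertices (M : RMC S) : Prop :=
  ∀ s, ∃ (r : S → ℝ) (d : ℝ), ∀ q ∈ vertices (M.uncertainty s), IsBasicPoint r d q

lemma HasLpUncertainty.hasBasicVertices {M : RMC S} {p : ℝ≥0∞} (hp : p = 1 ∨ p = ⊤)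
    (h : M.HasLpUncertainty p) : M.HasBasicVertices := by
  obtain ⟨r, δ, -, hball⟩ := h
  have hball' : ∀ s, M.uncertainty s = lpBall p (M.succ s) (r s) (δ s) := hball
  intro s
  have : Nonempty S := ⟨s⟩
  rcases hp with rfl | rfl
  · exact ⟨r s, δ s / 2, fun q hq => isBasicPoint_of_mem_vertices_lpBall_one (hball' s ▸ hq)⟩
  · exact ⟨r s, δ s, fun q hq => isBasicPoint_of_mem_vertices_lpBall_top (hball' s ▸ hq)⟩

end RMC

end BasicPoints

section Embedding

open scoped Matrix

variable {X Y : Type*} [Fintype X] [Fintype Y] {f : X → Y}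

lemma stdSimplex_map_apply (hf : f.Injective) (q : stdSimplex ℝ X) (x : X) :
    stdSimplex.map f q (f x) = q x := by
  classical
  rw [stdSimplex.map_coe, FunOnFinite.linearMap_apply_apply]
  simp only [hf.eq_iff, Finset.sum_filter, Finset.sum_ite_eq', Finset.mem_univ, if_true]

lemma stdSimplex_map_apply_of_notMem_range (q : stdSimplex ℝ X) {y : Y} (hy : y ∉ Set.range f) :
    stdSimplex.map f q y = 0 := by
  classical
  rw [stdSimplex.map_coe, FunOnFinite.linearMap_apply_apply]
  exact Finset.sum_eq_zero fun x hx => (hy ⟨x, (Finset.mem_filter.1 hx).2⟩).elim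

lemma stdSimplex_map_apply_of_notMem_image (hf : f.Injective) {A : Set X} {q : stdSimplex ℝ X}
    (hq : ∀ x ∉ A, q x = 0) {y : Y} (hy : y ∉ f '' A) : stdSimplex.map f q y = 0 := by
  by_cases hrange : y ∈ Set.range f
  · obtain ⟨x, rfl⟩ := hrange
    rw [stdSimplex_map_apply hf, hq x (mt (Set.mem_image_of_mem f) hy)]
  · exact stdSimplex_map_apply_of_notMem_range q hrange

lemma stdSimplex_map_dotProduct (hf : f.Injective) (q : stdSimplex ℝ X) (z : Y → ℝ) :
    ⇑(stdSimplex.map f q) ⬝ᵥ z = ⇑q ⬝ᵥ (z ∘ f) :=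
  (Fintype.sum_of_injective f hf _ _
    (fun y hy => by rw [stdSimplex_map_apply_of_notMem_range q hy, zero_mul])
    fun x => by rw [stdSimplex_map_apply hf q, Function.comp_apply]).symm

lemma stdSimplex_map_injective (hf : f.Injective) :
    Function.Injective (stdSimplex.map f : stdSimplex ℝ X → stdSimplex ℝ Y) := fun q r h =>
  stdSimplex.ext (funext fun x => by
    rw [← stdSimplex_map_apply hf q, h, stdSimplex_map_apply hf r])

lemma exists_stdSimplex_map_eq (hf : f.Injective) {q : stdSimplex ℝ Y}
    (hq : ∀ y ∉ Set.range f, q y = 0) : ∃ r : stdSimplex ℝ X, stdSimplex.map f r = q := by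
  have hsum : ∑ x, q (f x) = 1 :=
    (Fintype.sum_of_injective f hf _ _ hq fun _ => rfl).trans (stdSimplex.sum_eq_one q)
  refine ⟨⟨fun x => q (f x), fun x => stdSimplex.zero_le q _, hsum⟩,
    stdSimplex.ext (funext fun y => ?_)⟩
  by_cases hy : y ∈ Set.range f
  · obtain ⟨x, rfl⟩ := hy
    exact stdSimplex_map_apply hf _ x
  · rw [stdSimplex_map_apply_of_notMem_range _ hy, hq y hy]

lemma norm_toLp_comp {p : ℝ≥0∞} [Fact (1 ≤ p)] (hf : f.Injective) {g : Y → ℝ}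
    (hg : ∀ y ∉ Set.range f, g y = 0) :
    ‖(WithLp.toLp p (g ∘ f) : PiLp p fun _ : X => ℝ)‖ =
      ‖(WithLp.toLp p g : PiLp p fun _ : Y => ℝ)‖ := by
  rcases eq_or_ne p ⊤ with rfl | hp
  · refine le_antisymm ?_ ?_ <;> rw [PiLp.norm_eq_ciSup]
    · exact Real.iSup_le (fun x => PiLp.norm_apply_le (WithLp.toLp ⊤ g) (f x)) (norm_nonneg _)
    · refine Real.iSup_le (fun y => ?_) (norm_nonneg _)
      by_cases hy : y ∈ Set.range f
      · obtain ⟨x, rfl⟩ := hy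
        exact PiLp.norm_apply_le (WithLp.toLp ⊤ (g ∘ f)) x
      · simp [hg y hy]
  · have hp₀ : 0 < p.toReal :=
      ENNReal.toReal_pos (zero_lt_one.trans_le Fact.out).ne' hp
    rw [PiLp.norm_eq_sum hp₀, PiLp.norm_eq_sum hp₀]
    congr 1
    refine Fintype.sum_of_injective f hf _ _ (fun y hy => ?_) fun x => rfl
    simp [hg y hy, hp₀.ne']

lemma image_map_lpBall {p : ℝ≥0∞} [Fact (1 ≤ p)] (hf : f.Injective) (A : Set X)
    (r : stdSimplex ℝ X) (δ : ℝ) :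
    stdSimplex.map f '' lpBall p A r δ = lpBall p (f '' A) (stdSimplex.map f r) δ := by
  have hnorm : ∀ q : stdSimplex ℝ X,
      ‖(WithLp.toLp p (fun x => q x - r x) : PiLp p fun _ : X => ℝ)‖ =
        ‖(WithLp.toLp p (fun y => stdSimplex.map f q y - stdSimplex.map f r y) :
          PiLp p fun _ : Y => ℝ)‖ := fun q => by
    rw [← norm_toLp_comp hf fun y hy => by simp only [stdSimplex_map_apply_of_notMem_range _ hy,
      sub_zero]]
    simp only [Function.comp_def, stdSimplex_map_apply hf]
  ext q
  constructor
  · rintro ⟨q, ⟨hsupp, hq⟩, rfl⟩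
    exact ⟨fun y hy => stdSimplex_map_apply_of_notMem_image hf hsupp hy,
      (hnorm q).symm.trans_le hq⟩
  · rintro ⟨hsupp, hq⟩
    obtain ⟨q, rfl⟩ := exists_stdSimplex_map_eq hf fun y hy =>
      hsupp y (mt (Set.image_subset_range f A ·) hy)
    refine ⟨q, ⟨fun x hx => ?_, (hnorm q).trans_le hq⟩, rfl⟩
    rw [← stdSimplex_map_apply hf q]
    exact hsupp (f x) (mt hf.mem_set_image.1 hx)

lemma lpBall_zero {p : ℝ≥0∞} [Fact (1 ≤ p)] {A : Set X} {r : stdSimplex ℝ X}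
    (hr : ∀ x ∉ A, r x = 0) : lpBall p A r 0 = {r} := by
  ext q
  simp only [lpBall, Set.mem_ofPred_eq, Set.mem_singleton_iff, norm_le_zero_iff,
    WithLp.toLp_eq_zero]
  constructor
  · exact fun ⟨_, h⟩ => stdSimplex.ext (funext fun x => sub_eq_zero.1 (congrFun h x))
  · rintro rfl
    exact ⟨hr, funext fun x => sub_self _⟩

end Embedding

section Batch

open scoped Matrix

namespace RMC

variable {S : Type*} [Fintype S]

lemma ofChain_hasLpUncertainty {p : ℝ≥0∞} [Fact (1 ≤ p)] (c : S → ℝ) (P : S → stdSimplex ℝ S) :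
    (ofChain c P).HasLpUncertainty p :=
  have hsupp : ∀ s, ∀ s' ∉ (ofChain c P).succ s, P s s' = 0 := fun _ _ => not_not.1
  ⟨P, fun _ => 0, hsupp, fun s => (lpBall_zero (hsupp s)).symm⟩

variable [DecidableEq S]

lemma value_ofChain (M : RMC S) {γ : ℝ} (hγ₀ : 0 ≤ γ) (hγ₁ : γ < 1) (τ : S → stdSimplex ℝ S) :
    (ofChain M.cost τ).value γ = M.policyEval γ τ := by
  have himp : (ofChain M.cost τ).IsImprovement γ ((ofChain M.cost τ).policyEval γ τ) τ :=
    fun s => ⟨rfl, fun q hq => by rw [Set.mem_singleton_iff.1 hq]⟩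
  exact (himp.policyEval_eq_value hγ₀ hγ₁).symm

lemma HasLpUncertainty.batch {p : ℝ≥0∞} [Fact (1 ≤ p)] {M : RMC S} (h : M.HasLpUncertainty p)
    (γ : ℝ) (v : S → ℝ) : (M.batch γ v).HasLpUncertainty p := by
  obtain ⟨r, δ, hsupp, hball⟩ := h
  refine ⟨Sum.elim (fun s => stdSimplex.map Sum.inr (r s)) fun s => stdSimplex.vertex (Sum.inr s),
    Sum.elim δ 0, ?_, ?_⟩
  · rintro (s | s) x hx
    · exact stdSimplex_map_apply_of_notMem_image Sum.inr_injective (hsupp s) hx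
    · exact (M.batch γ v).supported (Sum.inr s) _ rfl x hx
  · rintro (s | s)
    · exact (congrArg (stdSimplex.map Sum.inr '' ·) (hball s)).trans
        (image_map_lpBall Sum.inr_injective _ _ _)
    · exact (lpBall_zero ((M.batch γ v).supported (Sum.inr s) _ rfl)).symm

/-- The policy of a batch robust Markov chain that moves from the transient copies according to
`τ`. -/
noncomputable def batchPolicy (τ : S → stdSimplex ℝ S) : S ⊕ S → stdSimplex ℝ (S ⊕ S) :=
  Sum.elim (fun s => stdSimplex.map Sum.inr (τ s)) fun s => stdSimplex.vertex (Sum.inr s)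

variable {M : RMC S} {γ : ℝ} {v : S → ℝ} {τ : S → stdSimplex ℝ S}

lemma isPolicy_batchPolicy_iff : (M.batch γ v).IsPolicy (batchPolicy τ) ↔ M.IsPolicy τ := by
  refine Sum.forall.trans ((and_iff_left fun s => rfl).trans (forall_congr' fun s => ?_))
  exact (stdSimplex_map_injective Sum.inr_injective).mem_set_image

lemma IsPolicy.eq_batchPolicy {σ : S ⊕ S → stdSimplex ℝ (S ⊕ S)}
    (hσ : (M.batch γ v).IsPolicy σ) (h : ∀ s, σ (Sum.inl s) = stdSimplex.map Sum.inr (τ s)) :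
    σ = batchPolicy τ := by
  rw [batchPolicy, ← Sum.elim_comp_inl_inr σ]
  exact congrArg₂ Sum.elim (funext h) (funext fun s => hσ (Sum.inr s))

variable (hγ₀ : 0 ≤ γ) (hγ₁ : γ < 1)
include hγ₀ hγ₁

variable (M v τ) in
lemma batch_policyEval_batchPolicy : (M.batch γ v).policyEval γ (batchPolicy τ) =
    Sum.elim (fun s => M.cost s + γ * (⇑(τ s) ⬝ᵥ v)) v := by
  refine ((M.batch γ v).eq_policyEval hγ₀ hγ₁ (batchPolicy τ) ?_).symm
  rintro (s | s)
  · simp only [batchPolicy, Sum.elim_inl, stdSimplex_map_dotProduct Sum.inr_injective,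
      Sum.elim_comp_inr]
    rfl
  · change v s = (1 - γ) * v s + γ * (Pi.single (Sum.inr s) 1 ⬝ᵥ _)
    rw [single_one_dotProduct, Sum.elim_inr]
    ring

lemma IsImprovement.batchPolicy_isOptimal (h : M.IsImprovement γ v τ) :
    (M.batch γ v).IsOptimal γ (batchPolicy τ) := by
  have hpol : (M.batch γ v).IsPolicy (batchPolicy τ) := isPolicy_batchPolicy_iff.2 h.isPolicy
  refine ((M.batch γ v).isOptimal_iff_policyEval_eq hγ₀ hγ₁).2
    ⟨hpol, policyEval_eq_value hγ₀ hγ₁ fun x => ⟨hpol x, ?_⟩⟩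
  rw [batch_policyEval_batchPolicy M v τ hγ₀ hγ₁]
  rcases x with s | s
  · rintro _ ⟨q, hq, rfl⟩
    change _ + γ * (⇑(stdSimplex.map Sum.inr q) ⬝ᵥ _) ≤
      _ + γ * (⇑(stdSimplex.map Sum.inr (τ s)) ⬝ᵥ _)
    simp only [stdSimplex_map_dotProduct Sum.inr_injective, Sum.elim_comp_inr]
    exact add_le_add_right (h.discounted_dotProduct_le hq) _
  · intro q hq
    rw [Set.mem_singleton_iff.1 hq]
    rfl

lemma IsOptimal.isImprovement_of_batchPolicy
    (h : (M.batch γ v).IsOptimal γ (batchPolicy τ)) : M.IsImprovement γ v τ := by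
  obtain ⟨hpol, hval⟩ := ((M.batch γ v).isOptimal_iff_policyEval_eq hγ₀ hγ₁).1 h
  obtain ⟨σ, hσ⟩ := M.exists_isImprovement hγ₀ v
  refine fun s => ⟨isPolicy_batchPolicy_iff.1 hpol s, fun q hq => ((hσ s).2 q hq).trans ?_⟩
  have hσpol : (M.batch γ v).IsPolicy (batchPolicy σ) := isPolicy_batchPolicy_iff.2 hσ.isPolicy
  have hle := hσpol.policyEval_le_value hγ₀ hγ₁ (Sum.inl s)
  rwa [← hval, batch_policyEval_batchPolicy M v σ hγ₀ hγ₁,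
    batch_policyEval_batchPolicy M v τ hγ₀ hγ₁] at hle

variable (M v τ) in
lemma isImprovement_iff_exists_isOptimal_batch : M.IsImprovement γ v τ ↔
    ∃ σ, (M.batch γ v).IsOptimal γ σ ∧
      ∀ s, σ (Sum.inl s) = stdSimplex.map Sum.inr (τ s) := by
  refine ⟨fun h => ⟨_, h.batchPolicy_isOptimal hγ₀ hγ₁, fun s => rfl⟩, ?_⟩
  rintro ⟨σ, hopt, hσ⟩
  rw [hopt.1.eq_batchPolicy hσ] at hopt
  exact hopt.isImprovement_of_batchPolicy hγ₀ hγ₁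

end RMC

end Batch

section PolicyIteration

open scoped Matrix

namespace RMC

variable {S : Type*} [Fintype S]

/-- The loss in Bellman's equation at `s` when the adversary plays `w` instead of a maximizer. -/
noncomputable def regret (M : RMC S) (γ : ℝ) (s : S) (w : stdSimplex ℝ S) : ℝ :=
  M.value γ s - (M.cost s + γ * (⇑w ⬝ᵥ M.value γ))

/-- A number of halvings after which the regret of the vertices chosen by policy iteration on `n`
states has vanished. The factor `n * (n * (2 * n + 1))` counts the reals of which all regrets are
integer combinations: a state, an exceptional coordinate and a basic term determine one. -/
def halvingBound (n : ℕ) : ℕ := 12 * (n * (n * (2 * n + 1))) * Nat.clog 2 n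

lemma halvingBound_pos {n : ℕ} (hn : 2 ≤ n) : 0 < halvingBound n := by
  have hclog : 0 < Nat.clog 2 n := Nat.clog_pos one_lt_two hn
  unfold halvingBound
  positivity

lemma two_mul_halvingBound_pow_lt {n : ℕ} (hn : 2 ≤ n) :
    (2 * halvingBound n) ^ (n * (n * (2 * n + 1))) < 2 ^ halvingBound n := by
  have hclog : 1 ≤ Nat.clog 2 n := Nat.clog_pos one_lt_two hn
  refine two_mul_pow_lt_two_pow hclog (by positivity) ?_
  have hpow : n ≤ 2 ^ Nat.clog 2 n := Nat.le_pow_clog one_lt_two n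
  calc n * (n * (2 * n + 1)) ≤ n * (n * (4 * n)) := by gcongr; lia
    _ = 4 * n ^ 3 := by ring
    _ ≤ 4 * (2 ^ Nat.clog 2 n) ^ 3 := by gcongr
    _ = 2 ^ (3 * Nat.clog 2 n + 2) := by ring

lemma exists_regret_nonpos_of_halving {M : RMC S} (hM : M.HasBasicVertices)
    (hn : 2 ≤ Fintype.card S) (γ : ℝ) {s : ℕ → S} {w : ℕ → stdSimplex ℝ S}
    (hw : ∀ j, w j ∈ vertices (M.uncertainty (s j)))
    (hhalf : ∀ j, 2 * M.regret γ (s (j + 1)) (w (j + 1)) ≤ M.regret γ (s j) (w j)) :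
    ∃ j < halvingBound (Fintype.card S), M.regret γ (s j) (w j) ≤ 0 := by
  classical
  have : Nonempty S := Fintype.card_pos_iff.1 (zero_lt_two.trans_le hn)
  choose r d hbasic using hM
  choose k c hc hcomb using fun j => (hbasic (s j) (w j) (hw j)).exists_sub_dotProduct_eq
  let x : S × S × Option (S ⊕ S) → ℝ := fun i =>
    basicTerms (r i.1) (d i.1) i.2.1 (γ • M.value γ) (M.value γ i.1 - M.cost i.1) i.2.2
  let a : ℕ → S × S × Option (S ⊕ S) → ℤ := fun j i =>
    if i.1 = s j then if i.2.1 = k j then c j i.2.2 else 0 else 0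
  have ha : ∀ j i, |a j i| ≤ 1 := fun j i => by
    simp only [a]
    split_ifs <;> simp [hc]
  have hsum : ∀ j, M.regret γ (s j) (w j) = ∑ i, a j i * x i := fun j => by
    rw [regret, ← sub_sub, ← smul_eq_mul γ, ← dotProduct_smul, hcomb j]
    simp [a, x, Fintype.sum_prod_type, Finset.sum_ite_irrel]
  have hcard : Fintype.card (S × S × Option (S ⊕ S)) =
      Fintype.card S * (Fintype.card S * (2 * Fintype.card S + 1)) := by
    simp only [Fintype.card_prod, Fintype.card_option, Fintype.card_sum, two_mul]
  exact exists_nonpos_of_halving hhalf x ha hsum (halvingBound_pos hn).ne'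
    (hcard ▸ two_mul_halvingBound_pow_lt hn)

lemma IsImprovement.exists_mem_vertices {M : RMC S} {γ : ℝ} {u : S → ℝ}
    {τ : S → stdSimplex ℝ S} (h : M.IsImprovement γ u τ) (s : S) :
    ∃ w ∈ vertices (M.uncertainty s),
      (∀ q ∈ M.uncertainty s, γ * (⇑q ⬝ᵥ u) ≤ γ * (⇑w ⬝ᵥ u)) ∧
      M.regret γ s (τ s) ≤ M.regret γ s w := by
  have hgreedy : ∀ q ∈ M.uncertainty s, γ * (⇑q ⬝ᵥ u) ≤ γ * (⇑(τ s) ⬝ᵥ u) := fun _ hq =>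
    h.discounted_dotProduct_le hq
  obtain ⟨w, hw, hu, hv⟩ := exists_mem_vertices_of_isMaxOn (M.isCompact s) (γ • u)
    (γ • M.value γ) (h.isPolicy s) (by simpa only [dotProduct_smul, smul_eq_mul] using hgreedy)
  simp only [dotProduct_smul, smul_eq_mul] at hu hv
  exact ⟨w, hw, fun q hq => (hgreedy q hq).trans hu, sub_le_sub_left (add_le_add_right hv _) _⟩

section Regret

variable (M : RMC S) {γ : ℝ} (hγ₀ : 0 ≤ γ) (hγ₁ : γ < 1)
include hγ₀ hγ₁

lemma isGreatest_value (s : S) :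
    IsGreatest ((fun q : stdSimplex ℝ S => M.cost s + γ * (⇑q ⬝ᵥ M.value γ)) '' M.uncertainty s)
      (M.value γ s) := by
  classical
  obtain ⟨σ, hσ⟩ := M.exists_isImprovement_policyEval_self hγ₀ hγ₁
  have happly := M.policyEval_apply hγ₀ hγ₁ σ s
  have hval := hσ.policyEval_eq_value hγ₀ hγ₁
  rw [hval] at hσ happly
  refine ⟨⟨σ s, (hσ s).1, happly.symm⟩, ?_⟩
  rintro _ ⟨q, hq, rfl⟩
  exact ((hσ s).2 q hq).trans_eq happly.symm

lemma regret_nonneg {s : S} {w : stdSimplex ℝ S} (hw : w ∈ M.uncertainty s) :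
    0 ≤ M.regret γ s w :=
  sub_nonneg.2 ((M.isGreatest_value hγ₀ hγ₁ s).2 (Set.mem_image_of_mem _ hw))

lemma value_sub_policyEval_le_of_regret_le [DecidableEq S] {τ : S → stdSimplex ℝ S} {y : ℝ}
    (h : ∀ s, M.regret γ s (τ s) ≤ y) (s : S) :
    M.value γ s - M.policyEval γ τ s ≤ y / (1 - γ) := by
  refine le_div_of_le_add_discounted hγ₀ hγ₁ τ (x := M.value γ - M.policyEval γ τ) (fun s => ?_) s
  have hreg := h s
  have happly := M.policyEval_apply hγ₀ hγ₁ τ s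
  rw [regret] at hreg
  rw [dotProduct_sub, Pi.sub_apply, mul_sub]
  linarith

lemma regret_le_of_isMaxOn {u : S → ℝ} (hu : u ≤ M.value γ) {e : ℝ}
    (he : ∀ s, M.value γ s - u s ≤ e) {s : S} {w : stdSimplex ℝ S}
    (hw : ∀ q ∈ M.uncertainty s, γ * (⇑q ⬝ᵥ u) ≤ γ * (⇑w ⬝ᵥ u)) : M.regret γ s w ≤ γ * e := by
  obtain ⟨q, hq, hqs⟩ := (M.isGreatest_value hγ₀ hγ₁ s).1
  have hdiff : γ * (⇑q ⬝ᵥ (M.value γ - u)) ≤ γ * e :=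
    mul_le_mul_of_nonneg_left (dotProduct_le_of_forall_le q he) hγ₀
  have hmono : γ * (⇑w ⬝ᵥ u) ≤ γ * (⇑w ⬝ᵥ M.value γ) :=
    mul_le_mul_of_nonneg_left (dotProduct_le_dotProduct_of_nonneg_left hu w.2.1) hγ₀
  have hgreedy := hw q hq
  dsimp only at hqs
  rw [dotProduct_sub, mul_sub] at hdiff
  rw [regret]
  linarith

end Regret

variable [DecidableEq S] {M : RMC S} {γ : ℝ} {τ : ℕ → S → stdSimplex ℝ S}

lemma IsPolicyIteration.isPolicy (h : M.IsPolicyIteration γ τ) : ∀ t, M.IsPolicy (τ t)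
  | 0 => h.1
  | t + 1 => (h.2 t).isPolicy

lemma StopsAt.policyEval_eq_value (hγ₀ : 0 ≤ γ) (hγ₁ : γ < 1) {T : ℕ} (hT : StopsAt τ T)
    (h : M.IsPolicyIteration γ τ) : M.policyEval γ (τ T) = M.value γ := by
  obtain ⟨hT₁, hfix⟩ := hT.1
  have himp := h.2 (T - 1)
  rw [Nat.sub_add_cancel hT₁, ← hfix] at himp
  exact himp.policyEval_eq_value hγ₀ hγ₁

lemma ConsistentTies.exists_stopsAt (h : M.ConsistentTies γ τ) {t : ℕ}
    (ht : M.policyEval γ (τ (t + 1)) = M.policyEval γ (τ t)) : ∃ T ≤ t + 2, StopsAt τ T := by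
  have hmem : t + 2 ∈ {t | 1 ≤ t ∧ τ t = τ (t - 1)} := ⟨Nat.le_add_left 1 _, h t ht⟩
  exact ⟨_, Nat.sInf_le hmem, Nat.sInf_mem ⟨_, hmem⟩, fun _ => Nat.sInf_le⟩

namespace IsPolicyIteration

variable (h : M.IsPolicyIteration γ τ) (hγ₀ : 0 ≤ γ) (hγ₁ : γ < 1)
include h hγ₀ hγ₁

lemma discounted_dotProduct_le_policyEval_succ (t : ℕ) {s : S} {q : stdSimplex ℝ S}
    (hq : q ∈ M.uncertainty s) :
    M.cost s + γ * (⇑q ⬝ᵥ M.policyEval γ (τ t)) ≤ M.policyEval γ (τ (t + 1)) s := by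
  have hmono : M.policyEval γ (τ t) ≤ M.policyEval γ (τ (t + 1)) :=
    M.le_policyEval_of_subsolution hγ₀ hγ₁ (τ (t + 1)) fun s =>
      (M.policyEval_apply hγ₀ hγ₁ (τ t) s).trans_le ((h.2 t s).2 _ (h.isPolicy t s))
  calc M.cost s + γ * (⇑q ⬝ᵥ M.policyEval γ (τ t))
      ≤ M.cost s + γ * (⇑(τ (t + 1) s) ⬝ᵥ M.policyEval γ (τ t)) := (h.2 t s).2 q hq
    _ ≤ M.cost s + γ * (⇑(τ (t + 1) s) ⬝ᵥ M.policyEval γ (τ (t + 1))) := by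
      gcongr
      exact dotProduct_le_dotProduct_of_nonneg_left hmono (τ (t + 1) s).2.1
    _ = M.policyEval γ (τ (t + 1)) s := (M.policyEval_apply hγ₀ hγ₁ (τ (t + 1)) s).symm

lemma error_succ_le {t : ℕ} {e : ℝ} (he : ∀ s, M.value γ s - M.policyEval γ (τ t) s ≤ e)
    (s : S) : M.value γ s - M.policyEval γ (τ (t + 1)) s ≤ γ * e := by
  obtain ⟨q, hq, hqs⟩ := (M.isGreatest_value hγ₀ hγ₁ s).1
  have hstep := h.discounted_dotProduct_le_policyEval_succ hγ₀ hγ₁ t hq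
  have hdiff : γ * (⇑q ⬝ᵥ (M.value γ - M.policyEval γ (τ t))) ≤ γ * e :=
    mul_le_mul_of_nonneg_left (dotProduct_le_of_forall_le q he) hγ₀
  dsimp only at hqs
  rw [dotProduct_sub, mul_sub] at hdiff
  linarith

lemma error_add_le {t : ℕ} {e : ℝ} (he : ∀ s, M.value γ s - M.policyEval γ (τ t) s ≤ e)
    (k : ℕ) : ∀ s, M.value γ s - M.policyEval γ (τ (t + k)) s ≤ γ ^ k * e := by
  induction k with
  | zero => simpa using he
  | succ k ih =>
    rw [pow_succ', mul_assoc]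
    exact h.error_succ_le hγ₀ hγ₁ ih

/- The vertex of largest regret among those that are greedy for the current values: its regret is
controlled by the current error and controls the next one. -/
lemma exists_regret [Nonempty S] (t : ℕ) :
    ∃ s, ∃ w ∈ vertices (M.uncertainty s),
      (∀ e, (∀ i, M.value γ i - M.policyEval γ (τ t) i ≤ e) → M.regret γ s w ≤ γ * e) ∧
      ∀ i, M.value γ i - M.policyEval γ (τ (t + 1)) i ≤ M.regret γ s w / (1 - γ) := by
  choose w hvert hgreedy hregret using (h.2 t).exists_mem_vertices
  obtain ⟨s, hs⟩ := Finite.exists_max fun i => M.regret γ i (w i)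
  refine ⟨s, w s, hvert s, fun e he => ?_,
    M.value_sub_policyEval_le_of_regret_le hγ₀ hγ₁ fun i => (hregret i).trans (hs i)⟩
  exact M.regret_le_of_isMaxOn hγ₀ hγ₁ ((h.isPolicy t).policyEval_le_value hγ₀ hγ₁) he (hgreedy s)

lemma exists_halving_regret [Nonempty S] {L : ℕ} (hL : L ≠ 0) (hγL : 2 * γ ^ L ≤ 1 - γ) :
    ∃ (s : ℕ → S) (w : ℕ → stdSimplex ℝ S), (∀ j, w j ∈ vertices (M.uncertainty (s j))) ∧
      (∀ j, 2 * M.regret γ (s (j + 1)) (w (j + 1)) ≤ M.regret γ (s j) (w j)) ∧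
      ∀ j i, M.value γ i - M.policyEval γ (τ (j * L + 1)) i ≤
        M.regret γ (s j) (w j) / (1 - γ) := by
  choose s w hvert hle herr using fun j => h.exists_regret hγ₀ hγ₁ (j * L)
  refine ⟨s, w, hvert, fun j => ?_, herr⟩
  obtain ⟨l, rfl⟩ := Nat.exists_eq_succ_of_ne_zero hL
  have hstep := h.error_add_le hγ₀ hγ₁ (herr j) l
  rw [show j * (l + 1) + 1 + l = (j + 1) * (l + 1) by ring] at hstep
  have hγ : 0 < 1 - γ := sub_pos.2 hγ₁
  calc 2 * M.regret γ (s (j + 1)) (w (j + 1))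
      ≤ 2 * (γ * (γ ^ l * (M.regret γ (s j) (w j) / (1 - γ)))) := by
        gcongr
        exact hle (j + 1) _ hstep
    _ = 2 * γ ^ (l + 1) * M.regret γ (s j) (w j) / (1 - γ) := by ring
    _ ≤ (1 - γ) * M.regret γ (s j) (w j) / (1 - γ) := by
        gcongr
        exact M.regret_nonneg hγ₀ hγ₁ (vertices_subset _ (hvert j))
    _ = M.regret γ (s j) (w j) := mul_div_cancel_left₀ _ hγ.ne'

lemma policyEval_eq_value (hM : M.HasBasicVertices) (hn : 2 ≤ Fintype.card S) {L : ℕ}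
    (hL : L ≠ 0) (hγL : 2 * γ ^ L ≤ 1 - γ) {t : ℕ}
    (ht : halvingBound (Fintype.card S) * L + 1 ≤ t) : M.policyEval γ (τ t) = M.value γ := by
  have : Nonempty S := Fintype.card_pos_iff.1 (zero_lt_two.trans_le hn)
  obtain ⟨s, w, hvert, hhalf, herr⟩ := h.exists_halving_regret hγ₀ hγ₁ hL hγL
  obtain ⟨j, hj, hnonpos⟩ := exists_regret_nonpos_of_halving hM hn γ hvert hhalf
  have hjt : j * L + 1 ≤ t := le_trans (by gcongr) ht
  have hzero : ∀ i, M.value γ i - M.policyEval γ (τ (j * L + 1)) i ≤ 0 := fun i =>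
    (herr j i).trans (div_nonpos_of_nonpos_of_nonneg hnonpos (sub_nonneg.2 hγ₁.le))
  have hfinal := h.error_add_le hγ₀ hγ₁ hzero (t - (j * L + 1))
  rw [Nat.add_sub_cancel' hjt, mul_zero] at hfinal
  exact le_antisymm ((h.isPolicy t).policyEval_le_value hγ₀ hγ₁) fun i => sub_nonpos.1 (hfinal i)

end IsPolicyIteration

end RMC

end PolicyIteration

section IterationBound

lemma two_mul_pow_ceil_le {γ : ℝ} (hγ₀ : 0 ≤ γ) (hγ₁ : γ < 1) {n : ℕ} (hn : 2 ≤ n) :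
    2 * γ ^ ⌈max 1 (Real.log ((1 - γ) / n) / Real.log γ)⌉₊ ≤ 1 - γ := by
  set L := ⌈max 1 (Real.log ((1 - γ) / n) / Real.log γ)⌉₊
  have hle : max 1 (Real.log ((1 - γ) / n) / Real.log γ) ≤ L := Nat.le_ceil _
  have hL : L ≠ 0 := (Nat.ceil_pos.2 (one_pos.trans_le (le_max_left _ _))).ne'
  rcases hγ₀.eq_or_lt with rfl | hpos
  · simp [hL]
  have hn' : (2 : ℝ) ≤ n := mod_cast hn
  have hlog : L * Real.log γ ≤ Real.log ((1 - γ) / n) :=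
    (div_le_iff_of_neg (Real.log_neg hpos hγ₁)).1 ((le_max_right _ _).trans hle)
  have hpow : γ ^ L ≤ (1 - γ) / n := by
    rwa [← Real.log_pow, Real.log_le_log_iff (pow_pos hpos L)
      (div_pos (sub_pos.2 hγ₁) (by positivity))] at hlog
  calc 2 * γ ^ L ≤ n * γ ^ L := by gcongr
    _ ≤ 1 - γ := (le_div_iff₀' (by positivity)).1 hpow

lemma half_le_log {n : ℕ} (hn : 2 ≤ n) : 1 / 2 ≤ Real.log n :=
  calc (1 : ℝ) / 2 ≤ Real.log 2 := by linarith [Real.log_two_gt_d9]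
    _ ≤ Real.log n := Real.log_le_log two_pos (mod_cast hn)

lemma clog_two_le_four_mul_log {n : ℕ} (hn : 2 ≤ n) : (Nat.clog 2 n : ℝ) ≤ 4 * Real.log n := by
  obtain ⟨k, hk⟩ := Nat.exists_eq_succ_of_ne_zero (Nat.clog_pos one_lt_two hn).ne'
  have hpow : (2 : ℝ) ^ k ≤ n := by
    have := Nat.pow_pred_clog_lt_self one_lt_two hn
    rw [hk] at this
    exact_mod_cast this.le
  have hlog : k * Real.log 2 ≤ Real.log n := by
    rw [← Real.log_pow]
    exact Real.log_le_log (by positivity) hpow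
  have hhalf : (k : ℝ) * (1 / 2) ≤ k * Real.log 2 := by
    gcongr
    exact_mod_cast half_le_log le_rfl
  rw [hk]
  push_cast
  linarith [half_le_log hn]

lemma halvingBound_mul_ceil_add_three_le {n : ℕ} (hn : 2 ≤ n) {Q : ℝ} (hQ : 1 ≤ Q) :
    ((RMC.halvingBound n * ⌈Q⌉₊ + 3 : ℕ) : ℝ) ≤ 300 * ((n : ℝ) ^ 3 * Real.log n * Q) := by
  have hn' : (2 : ℝ) ≤ n := mod_cast hn
  have hlog := half_le_log hn
  have hclog := clog_two_le_four_mul_log hn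
  have hceil : (⌈Q⌉₊ : ℝ) ≤ 2 * Q := Nat.ceil_le_two_mul (by linarith)
  have hlarge : (2 : ℝ) ^ 3 * (1 / 2) * 1 ≤ n ^ 3 * Real.log n * Q := by gcongr
  have hcube : (n : ℝ) * (n * (2 * n + 1)) ≤ 5 / 2 * n ^ 3 := by
    nlinarith [mul_nonneg (sq_nonneg (n : ℝ)) (sub_nonneg.2 hn')]
  calc ((RMC.halvingBound n * ⌈Q⌉₊ + 3 : ℕ) : ℝ)
      = 12 * (n * (n * (2 * n + 1))) * Nat.clog 2 n * ⌈Q⌉₊ + 3 := by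
        rw [RMC.halvingBound]
        push_cast
        rfl
    _ ≤ 12 * (5 / 2 * n ^ 3) * (4 * Real.log n) * (2 * Q) + 3 := by gcongr
    _ ≤ 300 * (n ^ 3 * Real.log n * Q) := by linarith

end IterationBound

theorem theorem2 :
    ∃ C : ℝ, ∀ (S : Type) [Fintype S] [DecidableEq S] (M : RMC S) (p : ENNReal) (γ : ℝ),
      2 ≤ Fintype.card S → p = 1 ∨ p = ⊤ → M.HasLpUncertainty p → 0 ≤ γ → γ < 1 →
      ∀ (N : ℝ), N = C * ((Fintype.card S : ℝ) ^ 3 * Real.log (Fintype.card S) *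
          max 1 (Real.log ((1 - γ) / Fintype.card S) / Real.log γ)) →
      ∀ τ : ℕ → S → stdSimplex ℝ S, M.IsPolicyIteration γ τ →
        -- the stopping test succeeds after at most `N` iterations, at an optimal policy
        (M.ConsistentTies γ τ → ∃ T : ℕ, RMC.StopsAt τ T ∧ (T : ℝ) ≤ N ∧
          M.IsOptimal γ (τ T) ∧ M.policyEval γ (τ T) = M.value γ) ∧
        -- however ties are broken, all policies from iteration `N` on are optimal
        (∀ t : ℕ, N ≤ t → M.IsOptimal γ (τ t) ∧ M.policyEval γ (τ t) = M.value γ) ∧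
        -- each iteration amounts to solving two robust Markov chains of the same kind
        (∀ t : ℕ,
          (RMC.ofChain M.cost (τ t)).HasLpUncertainty p ∧
          (RMC.ofChain M.cost (τ t)).value γ = M.policyEval γ (τ t) ∧
          (M.batch γ (M.policyEval γ (τ t))).HasLpUncertainty p ∧
          ∀ τ' : S → stdSimplex ℝ S, M.IsImprovement γ (M.policyEval γ (τ t)) τ' ↔
            ∃ σ, (M.batch γ (M.policyEval γ (τ t))).IsOptimal γ σ ∧
              ∀ s, σ (Sum.inl s) = stdSimplex.map Sum.inr (τ' s)) := by
  refine ⟨300, ?_⟩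
  intro S _ _ M p γ hn hp hM hγ₀ hγ₁ N hN τ hτ
  have : Fact (1 ≤ p) := ⟨by rcases hp with rfl | rfl <;> simp⟩
  have hQ := le_max_left 1 (Real.log ((1 - γ) / Fintype.card S) / Real.log γ)
  have hbound := halvingBound_mul_ceil_add_three_le hn hQ
  rw [← hN] at hbound
  have hconv := fun t => hτ.policyEval_eq_value hγ₀ hγ₁ (hM.hasBasicVertices hp) hn
    (Nat.ceil_pos.2 (one_pos.trans_le hQ)).ne' (two_mul_pow_ceil_le hγ₀ hγ₁ hn) (t := t)
  set B := RMC.halvingBound (Fintype.card S) *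
    ⌈max 1 (Real.log ((1 - γ) / Fintype.card S) / Real.log γ)⌉₊
  have hopt : ∀ t, M.policyEval γ (τ t) = M.value γ → M.IsOptimal γ (τ t) := fun t ht =>
    (M.isOptimal_iff_policyEval_eq hγ₀ hγ₁).2 ⟨hτ.isPolicy t, ht⟩
  refine ⟨fun hties => ?_, fun t ht => ?_, fun t => ⟨RMC.ofChain_hasLpUncertainty _ _,
    M.value_ofChain hγ₀ hγ₁ _, hM.batch γ _, fun τ' =>
      M.isImprovement_iff_exists_isOptimal_batch _ τ' hγ₀ hγ₁⟩⟩
  · obtain ⟨T, hTB, hT⟩ := hties.exists_stopsAt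
      ((hconv (B + 2) (by lia)).trans (hconv (B + 1) le_rfl).symm)
    have hval := hT.policyEval_eq_value hγ₀ hγ₁ hτ
    exact ⟨T, hT, (Nat.cast_le.2 hTB).trans hbound, hopt T hval, hval⟩
  · have hBt : B + 3 ≤ t := by exact_mod_cast hbound.trans ht
    have hval := hconv t (by lia)
    exact ⟨hopt t hval, hval⟩
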